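/- Let $X,Y,Z$ take values in standard Borel spaces, and let $\{P_\theta:\theta\in\Theta\}$, with $\Theta\subseteq\mathbb R$ open, be a family of laws of $(X,Y,Z)$ with densities $p_\theta$ with respect to a $\sigma$-finite measure $\mu$. Fix $\theta_0\in\Theta$ and suppose that the family is quadratic mean differentiable at $\theta_0$: there is a measurable $\eta$ with $$\int\left(\sqrt{p_{\theta_0+t}}-\sqrt{p_{\theta_0}}-t\,\eta\right)^2d\mu=o(t^2)\qquad(t\to0).$$ Let $s=2\eta/\sqrt{p_{\theta_0}}$ be the score at $\theta_0$ (set to $0$ where $p_{\theta_0}=0$). Suppose that $X$ and $Y$ are conditionally independent given $Z$ under $P_{\theta_0}$. The subscript $H_0$ refers to $P_{\theta_0}$ for a single observation and to $P_{\theta_0}^n$ for an i.i.d. sample $(\mathbf X,\mathbf Y,\mathbf Z)=(X_i,Y_i,Z_i)_{i=1}^n$. Let $\psi$ be measurable and integrable under $P_{\theta_0}$, put $e_0(Y,Z)=\mathbb E_{H_0}[\psi(X,Y,Z)\mid Y,Z]$, and assume that $0<\operatorname{Var}_{H_0}(\psi(X,Y,Z)-e_0(Y,Z))<\infty$. Let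 $T_n$ be measurable statistics with $$T_n(\mathbf X,\mathbf Y,\mathbf Z)=n^{-1/2}\sum_{i=1}^n\psi(X_i,Y_i,Z_i)+o_{\mathbb P_{H_0}}(1).$$ Let $\alpha\in(0,1)$. For each $n$ let $\phi_n$ be a level-$\alpha$ conditional randomization test (CRT) based on $T_n$: for a cutoff $c_n(\mathbf Y,\mathbf Z)$, it rejects when $T_n>c_n$, accepts when $T_n<c_n$ and possibly randomizes when $T_n=c_n$. Its conditional size is exactly $\alpha$: for $P_{\theta_0}^n$-almost every $(\mathbf Y,\mathbf Z)$, its rejection probability at $(\tilde{\mathbf X},\mathbf Y,\mathbf Z)$ is $\alpha$ when, given $(\mathbf Y,\mathbf Z)$, the $\tilde X_i$ are drawn independently from the conditional law of $X$ given $Z=Z_i$ under $P_{\theta_0}$. Then, for every fixed $h\in\mathbb R$, the unconditional rejection probability of $\phi_n$ under the local alternative $P^n_{\theta_0+h/\sqrt n}$ converges, as $n\to\infty$, to $$1-\Phi\left(z_{1-\alpha}-h\sqrt{\operatorname{Var}_{H_0}(s(X,Y,Z))}\;\operatorname{Corr}_{H_0}\bigl(\psi(X,Y,Z)-e_0(Y,Z),\,s(X,Y,Z)\bigr)\right),$$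 where $\Phi$ is the standard normal distribution function, $\Phi(z_{1-\alpha})=1-\alpha$, and a correlation with a degenerate variable is $0$. Moreover, if $\theta\mapsto p_\theta(x,y,z)$ is differentiable at $\theta_0$ for $P_{\theta_0}$-almost every $(x,y,z)$, then, $P_{\theta_0}$-almost everywhere, $$s=\frac{\frac{\partial}{\partial\theta}\big|_{\theta=\theta_0}p_\theta}{p_{\theta_0}}.$$ -/

import Mathlib

open MeasureTheory ProbabilityTheory Filter Topology

noncomputable section

namespace LocalCRT

/-- The standard normal distribution function `Φ`. -/
def stdNormalCDF (x : ℝ) : ℝ := cdf (gaussianReal 0 1) x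

/-- The `β`-quantile `z_β` of the standard normal distribution, for `β ∈ (0,1)`. -/
def stdNormalQuantile (β : ℝ) : ℝ := sInf {x : ℝ | β ≤ stdNormalCDF x}

/-- Pearson correlation of `f` and `g` under `μ`, with the convention `0 / 0 = 0`. -/
def corr {S : Type*} [MeasurableSpace S] (f g : S → ℝ) (μ : Measure S) : ℝ :=
  cov[f, g; μ] / (√(Var[f; μ]) * √(Var[g; μ]))

/-- The law of `n` i.i.d. observations from `P`. -/
def iidLaw {S : Type*} [MeasurableSpace S] (P : Measure S) (n : ℕ) : Measure (Fin n → S) :=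
  Measure.pi fun _ => P

/-- `p θ` is a density of `P θ` with respect to `μ`, for every `θ ∈ Θ`. -/
def IsDensityOn {S : Type*} [MeasurableSpace S] (P : ℝ → Measure S) (μ : Measure S)
    (p : ℝ → S → ℝ) (Θ : Set ℝ) : Prop :=
  ∀ θ ∈ Θ, Measurable (p θ) ∧ (∀ w, 0 ≤ p θ w) ∧
    P θ = μ.withDensity fun w => ENNReal.ofReal (p θ w)

/-- Quadratic mean differentiability at `θ₀` of a family of `μ`-densities with a scalar parameter,
with quadratic mean derivative `η`:
`∫ (√p_{θ₀+t} - √p_{θ₀} - t η)² dμ = o(t²)` as `t → 0`. -/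
def IsQMDAt {S : Type*} [MeasurableSpace S] (μ : Measure S) (p : ℝ → S → ℝ) (θ₀ : ℝ)
    (η : S → ℝ) : Prop :=
  Measurable η ∧
    Tendsto
      (fun t : ℝ =>
        (∫⁻ w, ENNReal.ofReal ((√(p (θ₀ + t) w) - √(p θ₀ w) - t * η w) ^ 2) ∂μ) /
          ENNReal.ofReal (t ^ 2))
      (𝓝[≠] 0) (𝓝 0)

/-- The score function at `θ₀`, `s = 2 η / √p_{θ₀}`, of a family with quadratic mean
derivative `η` (it is set to `0` on the `P_{θ₀}`-null set where `p_{θ₀} = 0`). -/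
def score {S : Type*} (p : ℝ → S → ℝ) (θ₀ : ℝ) (η : S → ℝ) (w : S) : ℝ :=
  2 * η w / √(p θ₀ w)

/-- `T_n = n^{-1/2} ∑ ψ(W_i) + o_P(1)` for i.i.d. observations `W_i` from `P`. -/
def IsAsympLinear {S : Type*} [MeasurableSpace S] (P : Measure S) (T : ∀ n : ℕ, (Fin n → S) → ℝ)
    (ψ : S → ℝ) : Prop :=
  ∀ ε : ℝ, 0 < ε →
    Tendsto (fun n : ℕ => iidLaw P n {w | ε ≤ |T n w - (∑ i, ψ (w i)) / √(n : ℝ)|})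
      atTop (𝓝 0)

section CRT

variable {𝓧 𝓨 𝓩 : Type*} [MeasurableSpace 𝓧] [MeasurableSpace 𝓨] [MeasurableSpace 𝓩]

/-- `e₀(Y, Z) = E[ψ(X, Y, Z) | Y, Z]` under `P`, where `(X, Y, Z)` is the identity map. -/
def condMeanYZ (P : Measure (𝓧 × 𝓨 × 𝓩)) (ψ : 𝓧 × 𝓨 × 𝓩 → ℝ) : 𝓧 × 𝓨 × 𝓩 → ℝ :=
  P[ψ | MeasurableSpace.comap Prod.snd inferInstance]

/-- The residual `ψ(X, Y, Z) - e₀(Y, Z)`. -/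
def residual (P : Measure (𝓧 × 𝓨 × 𝓩)) (ψ : 𝓧 × 𝓨 × 𝓩 → ℝ) (w : 𝓧 × 𝓨 × 𝓩) : ℝ :=
  ψ w - condMeanYZ P ψ w

variable [StandardBorelSpace 𝓧] [Nonempty 𝓧]

/-- The law from which the CRT resamples `X̃` given the data `(Y_i, Z_i)`: the coordinates are
independent and `X̃_i` has the conditional law of `X` given `Z = Z_i` under `P`. -/
def resampleLaw (P : Measure (𝓧 × 𝓨 × 𝓩)) [IsProbabilityMeasure P] {n : ℕ}
    (v : Fin n → 𝓨 × 𝓩) : Measure (Fin n → 𝓧) :=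
  Measure.pi fun i => condDistrib (fun w : 𝓧 × 𝓨 × 𝓩 => w.1) (fun w => w.2.2) P (v i).2

/-- `φ` (the probability of rejecting, given the data) is the one-sided level-`α` conditional
randomization test with statistic `T` and cutoff `c(Y, Z)`, for the null distribution `P`:
it rejects when `T > c`, accepts when `T < c`, possibly randomizes when `T = c`, and
its rejection probability under resampling of `X̃ | Y, Z` is exactly `α`. -/
structure IsCRT (P : Measure (𝓧 × 𝓨 × 𝓩)) [IsProbabilityMeasure P] (α : ℝ) {n : ℕ}
    (T : (Fin n → 𝓧 × 𝓨 × 𝓩) → ℝ) (c : (Fin n → 𝓨 × 𝓩) → ℝ)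
    (φ : (Fin n → 𝓧 × 𝓨 × 𝓩) → ℝ) : Prop where
  measurable_cutoff : Measurable c
  measurable_test : Measurable φ
  mem_unit : ∀ w, φ w ∈ Set.Icc (0 : ℝ) 1
  reject : ∀ w, c (fun i => (w i).2) < T w → φ w = 1
  accept : ∀ w, T w < c (fun i => (w i).2) → φ w = 0
  size : ∀ᵐ w ∂(iidLaw P n),
    ∫ x, φ (fun i => (x i, (w i).2)) ∂(resampleLaw P fun i => (w i).2) = α

end CRT

end LocalCRT

end

/-!
Write `r = ψ - e₀` for the residual, `σ²` for its variance, `R_n = n^{-1/2} ∑ r(W_i)` and `z` for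
the `1 - α` quantile of the standard normal law. The proof compares the conditional randomization
test with the test that rejects when `R_n > σ z`.

*Under the null hypothesis the two tests agree asymptotically*
(`tendsto_integral_abs_crt_sub_indicator`). Conditional independence lets an observation be written
as a function of `(Y, Z)` and an independent uniform variable (`map_quantileObs`), so that
resampling is integration over the uniform variables. Since `T_n - R_n` is a function of `(Y, Z)` up
to an error that tends to zero in probability, the sign of the difference of the two tests is, up to
that error and the event that `R_n` is close to `σ z`, determined by `(Y, Z)`. Hence the `L¹`
distance of the tests is controlled by the difference of their conditional sizes
(`integral_abs_sub_indicator_le`); the convergence of the cutoffs is not needed. One of the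
conditional sizes is `α`, and the other one converges to `α` in mean square
(`tendsto_integral_abs_sub_condTail`), because two copies of `R_n` that are conditionally
independent given `(Y, Z)` are uncorrelated, hence asymptotically independent by the bivariate
central limit theorem.

*The agreement carries over to the local alternatives* by contiguity
(`IsQMDSeq.tendsto_integral_zero`). Let `u_n` be the square root of the density of the alternative
and `u₀` that of the null density. The alternative is replaced by a law with half-density
proportional to `u₀ (1 + g / √n)`, where `g` is bounded and `u₀ g` approximates `h η` in `L²(μ)`.
The product laws are then close in Hellinger distance, and the likelihood ratio of the replacement
with respect to the null product law is bounded in mean square, uniformly in `n`. That `u₀ g` can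
approximate `h η` requires `η = 0` almost everywhere on `{u₀ = 0}` (`IsQMDAt.ae_eq_zero`), which
holds because `θ₀` is approached from both sides.

*The power of the comparison test* is computed from the characteristic function of `R_n` under the
alternative (`IsQMDSeq.tendsto_real_sum_div_sqrt`), with no expansion of the log-likelihood: with
`d_n = √n (u_n - u₀)`, one has `n (u_n² - u₀²) = 2 √n u₀ d_n + d_n²`, so that
`n (E_n[exp(i t r / √n)] - 1)` converges to `i t h E[r s] - t² σ² / 2`. Therefore `R_n` is
asymptotically `N(h E[r s], σ²)`, and `E[r s]` is the covariance of `r` and the score `s`.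

The formula for the score in the differentiable case follows by Fatou's lemma, as the pointwise
and the quadratic mean derivatives of `√p_θ` agree (`IsQMDAt.score_ae_eq`).
-/

namespace LocalCRT

/-! ### Half-densities and quadratic mean differentiable sequences -/

/-- The Cauchy–Schwarz inequality for products of square integrable real functions. -/
lemma integral_abs_mul_abs_le_sqrt_mul_sqrt {S : Type*} [MeasurableSpace S] {μ : Measure S}
    {f g : S → ℝ} (hf : MemLp f 2 μ) (hg : MemLp g 2 μ) :
    ∫ w, |f w| * |g w| ∂μ ≤ √(∫ w, f w ^ 2 ∂μ) * √(∫ w, g w ^ 2 ∂μ) := by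
  have h := integral_mul_norm_le_Lp_mul_Lq (μ := μ) (f := f) (g := g)
    Real.HolderConjugate.two_two (by simpa using hf) (by simpa using hg)
  simpa [Real.sqrt_eq_rpow] using h

/-- The measure whose density with respect to `μ` is the square of the half-density `u`. -/
noncomputable def sqMeasure {S : Type*} [MeasurableSpace S] (μ : Measure S) (u : S → ℝ) :
    Measure S :=
  μ.withDensity fun w => ENNReal.ofReal (u w ^ 2)

section sqMeasure

variable {S : Type*} [MeasurableSpace S] {μ : Measure S} {u : S → ℝ}

lemma integral_sqMeasure {E : Type*} [NormedAddCommGroup E] [NormedSpace ℝ E]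
    (hu : Measurable u) (f : S → E) :
    ∫ w, f w ∂(sqMeasure μ u) = ∫ w, u w ^ 2 • f w ∂μ := by
  rw [sqMeasure, integral_withDensity_eq_integral_toReal_smul (by fun_prop) (by simp)]
  simp [ENNReal.toReal_ofReal, sq_nonneg]

lemma integrable_sqMeasure_iff {E : Type*} [NormedAddCommGroup E] [NormedSpace ℝ E]
    (hu : Measurable u) {f : S → E} :
    Integrable f (sqMeasure μ u) ↔ Integrable (fun w => u w ^ 2 • f w) μ := by
  rw [sqMeasure, integrable_withDensity_iff_integrable_smul' (by fun_prop) (by simp)]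
  simp [ENNReal.toReal_ofReal, sq_nonneg]

lemma isProbabilityMeasure_sqMeasure (hu : MemLp u 2 μ) (h1 : ∫ w, u w ^ 2 ∂μ = 1) :
    IsProbabilityMeasure (sqMeasure μ u) := by
  refine ⟨?_⟩
  rw [sqMeasure, withDensity_apply _ MeasurableSet.univ, Measure.restrict_univ,
    ← ofReal_integral_eq_lintegral_ofReal hu.integrable_sq (ae_of_all _ fun _ => sq_nonneg _), h1,
    ENNReal.ofReal_one]

lemma memLp_two_mul_of_memLp_sqMeasure (hu : Measurable u) {r : S → ℝ} (hr : Measurable r)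
    (h : MemLp r 2 (sqMeasure μ u)) : MemLp (fun w => r w * u w) 2 μ := by
  rw [memLp_two_iff_integrable_sq (by fun_prop)]
  have := h.integrable_sq
  rw [integrable_sqMeasure_iff hu] at this
  refine this.congr (ae_of_all _ fun w => ?_)
  simp only [smul_eq_mul]
  ring

end sqMeasure

/-- A sequence of unit half-densities `u n` that approaches the unit half-density `u₀` along the
direction `a` at rate `n^{-1/2}` in `L²(μ)`. The direction is required to vanish where `u₀` does;
the half-densities may have any sign. -/
structure IsQMDSeq {S : Type*} [MeasurableSpace S] (μ : Measure S) (u₀ : S → ℝ)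
    (u : ℕ → S → ℝ) (a : S → ℝ) : Prop where
  measurable_base : Measurable u₀
  measurable_seq : ∀ n, Measurable (u n)
  measurable_dir : Measurable a
  memLp_base : MemLp u₀ 2 μ
  memLp_seq : ∀ n, MemLp (u n) 2 μ
  memLp_dir : MemLp a 2 μ
  integral_base : ∫ w, u₀ w ^ 2 ∂μ = 1
  integral_seq : ∀ n, ∫ w, u n w ^ 2 ∂μ = 1
  dir_eq_zero : ∀ᵐ w ∂μ, u₀ w = 0 → a w = 0
  tendsto : Tendsto (fun n : ℕ => ∫ w, (√n * (u n w - u₀ w) - a w) ^ 2 ∂μ) atTop (𝓝 0)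

/-! ### Characteristic functions of normalized sums -/

section CharFun

open Complex

variable {S : Type*} [MeasurableSpace S]

lemma charFun_map_sum_div_sqrt (Q : Measure S) [IsProbabilityMeasure Q] {r : S → ℝ}
    (hr : Measurable r) (n : ℕ) (t : ℝ) :
    charFun ((iidLaw Q n).map fun w => (∑ i, r (w i)) / √n) t =
      (∫ w, cexp ((t * (r w / √n) : ℝ) * I) ∂Q) ^ n := by
  have hm : Measurable fun w : Fin n → S => (∑ i, r (w i)) / √n :=
    (Finset.univ.measurable_fun_sum fun i _ => hr.comp (measurable_pi_apply i)).div_const _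
  rw [charFun_apply_real, integral_map hm.aemeasurable (by fun_prop)]
  have h := integral_fintype_prod_eq_pow (ι := Fin n) (μ := Q)
    (fun w => cexp ((t * (r w / √n) : ℝ) * I))
  rw [Fintype.card_fin] at h
  rw [← h, iidLaw]
  refine integral_congr_ae (ae_of_all _ fun w => ?_)
  simp only [← Complex.exp_sum, Finset.sum_div]
  push_cast
  simp only [Finset.mul_sum, Finset.sum_mul]

lemma tendsto_div_sqrt_nat (x : ℝ) : Tendsto (fun n : ℕ => x / √n) atTop (𝓝 0) :=
  Tendsto.div_atTop tendsto_const_nhds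
    (Real.tendsto_sqrt_atTop.comp tendsto_natCast_atTop_atTop)

/-- Second order expansion of the characteristic function of a centered, square integrable
variable, at the scale `n^{-1/2}`. -/
lemma tendsto_nat_mul_integral_exp_sub_one (P : Measure S) [IsProbabilityMeasure P] {r : S → ℝ}
    (hr : Measurable r) (hr2 : MemLp r 2 P) (h0 : ∫ w, r w ∂P = 0) (t : ℝ) :
    Tendsto (fun n : ℕ => (n : ℂ) * (∫ w, cexp ((t * (r w / √n) : ℝ) * I) ∂P - 1)) atTop
      (𝓝 (-(t ^ 2 * (∫ w, r w ^ 2 ∂P : ℝ)) / 2)) := by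
  have : IsProbabilityMeasure (P.map r) := Measure.isProbabilityMeasure_map hr.aemeasurable
  have hid : MemLp id 2 (P.map r) := by
    rw [memLp_map_measure_iff (by fun_prop) (by fun_prop)]
    simpa using hr2
  have hT : (fun t : ℝ => charFun (P.map r) t - (1 - (∫ w, r w ^ 2 ∂P : ℝ) * (t : ℂ) ^ 2 / 2))
      =o[𝓝 0] fun t => t ^ 2 := by
    have h := taylor_isLittleO_univ (f := charFun (P.map r)) (x₀ := 0) (n := 2)
      (contDiff_charFun (by simpa using hid))
    have e : ∀ t : ℝ, taylorWithinEval (charFun (P.map r)) 2 Set.univ 0 t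
        = 1 - (∫ w, r w ^ 2 ∂P : ℝ) * (t : ℂ) ^ 2 / 2 := by
      intro t
      rw [taylorWithinEval_charFun_two_zero hr.aemeasurable hid, h0]
      simp
    simp only [e, sub_zero] at h
    exact h
  have hs := hT.comp_tendsto (tendsto_div_sqrt_nat t)
  have h2 : (fun n : ℕ => (n : ℂ) * (charFun (P.map r) (t / √n) -
      (1 - (∫ w, r w ^ 2 ∂P : ℝ) * ((t / √n : ℝ) : ℂ) ^ 2 / 2))) =o[atTop]
      fun n : ℕ => (n : ℝ) * (t / √n) ^ 2 := by
    refine Asymptotics.IsBigO.mul_isLittleO ?_ hs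
    exact Asymptotics.isBigO_of_le _ fun n => by simp
  have h3 : Tendsto (fun n : ℕ => (n : ℂ) * (charFun (P.map r) (t / √n) -
      (1 - (∫ w, r w ^ 2 ∂P : ℝ) * ((t / √n : ℝ) : ℂ) ^ 2 / 2))) atTop (𝓝 0) := by
    refine (Asymptotics.isLittleO_one_iff ℝ).1 (h2.trans_isBigO ?_)
    refine Asymptotics.IsBigO.of_bound (t ^ 2) (Eventually.of_forall fun n => ?_)
    rcases Nat.eq_zero_or_pos n with rfl | hn
    · simp [sq_nonneg]
    · rw [div_pow, Real.sq_sqrt (by positivity), mul_div_cancel₀ _ (by positivity)]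
      simp
  have h4 := h3.add_const (-(t ^ 2 * (∫ w, r w ^ 2 ∂P : ℝ) : ℂ) / 2)
  rw [zero_add] at h4
  refine h4.congr' ?_
  filter_upwards [eventually_gt_atTop 0] with n hn
  have e1 : charFun (P.map r) (t / √n) = ∫ w, cexp ((t * (r w / √n) : ℝ) * I) ∂P := by
    rw [charFun_apply_real, integral_map (by fun_prop) (by fun_prop)]
    refine integral_congr_ae (ae_of_all _ fun w => ?_)
    simp only
    push_cast
    ring_nf
  have e2 : (n : ℂ) * ((t / √n : ℝ) : ℂ) ^ 2 = t ^ 2 := by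
    have : (n : ℝ) * (t / √n) ^ 2 = t ^ 2 := by
      rw [div_pow, Real.sq_sqrt (by positivity), mul_div_cancel₀ _ (by positivity)]
    exact_mod_cast congrArg (fun x : ℝ => (x : ℂ)) this
  rw [e1]
  linear_combination ((∫ w, r w ^ 2 ∂P : ℝ) : ℂ) / 2 * e2

lemma norm_exp_mul_I_sub_one_le_abs (x : ℝ) : ‖cexp ((x : ℝ) * I) - 1‖ ≤ |x| := by
  have := Real.norm_exp_I_mul_ofReal_sub_one_le (x := x)
  rwa [mul_comm, Real.norm_eq_abs] at this

lemma norm_exp_mul_I_sub_one_le_two (x : ℝ) : ‖cexp ((x : ℝ) * I) - 1‖ ≤ 2 := by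
  refine (norm_sub_le _ _).trans ?_
  rw [norm_exp_ofReal_mul_I, norm_one]
  norm_num

lemma tendsto_sqrt_mul_exp_sub_one (x : ℝ) :
    Tendsto (fun n : ℕ => (√n : ℂ) * (cexp ((x / √n : ℝ) * I) - 1)) atTop (𝓝 (x * I)) := by
  have h : HasDerivAt (fun y : ℝ => cexp ((y : ℂ) * I)) I 0 := by
    have h1 : HasDerivAt (fun y : ℝ => (y : ℂ) * I) I 0 := by
      simpa using (Complex.ofRealCLM.hasDerivAt (x := 0)).mul_const I
    simpa using h1.cexp
  have h2 := (h.hasFDerivAt.lim_real x).comp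
    (Real.tendsto_sqrt_atTop.comp tendsto_natCast_atTop_atTop)
  refine (h2.congr fun n => ?_).trans_eq ?_
  · simp [div_eq_inv_mul]
  · simp

lemma norm_sqrt_mul_exp_sub_one_le (x : ℝ) (n : ℕ) :
    ‖(√n : ℂ) * (cexp ((x / √n : ℝ) * I) - 1)‖ ≤ |x| := by
  rw [norm_mul, Complex.norm_real, Real.norm_of_nonneg (Real.sqrt_nonneg _)]
  refine (mul_le_mul_of_nonneg_left (norm_exp_mul_I_sub_one_le_abs _) (Real.sqrt_nonneg _)).trans ?_
  rw [abs_div, abs_of_nonneg (Real.sqrt_nonneg (n : ℝ))]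
  rcases Nat.eq_zero_or_pos n with rfl | hn
  · simp
  · rw [mul_div_cancel₀ _ (by positivity)]

variable {μ : Measure S} {u₀ : S → ℝ} {u : ℕ → S → ℝ} {a : S → ℝ}

lemma IsQMDSeq.memLp_remainder (hq : IsQMDSeq μ u₀ u a) (n : ℕ) :
    MemLp (fun w => √n * (u n w - u₀ w) - a w) 2 μ :=
  (((hq.memLp_seq n).sub hq.memLp_base).const_mul _).sub hq.memLp_dir

/-- The first order effect of the perturbation of the half-density on a characteristic function:
writing `d = √n (u n - u₀)`, one has `n ((u n)² - u₀²) = 2 √n u₀ d + d²`, where the linear term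
converges by dominated convergence and the quadratic term is damped by `e^{i t r / √n} - 1`. -/
lemma IsQMDSeq.tendsto_nat_mul_integral_exp_sub (hq : IsQMDSeq μ u₀ u a) {r : S → ℝ}
    (hr : Measurable r) (hru : MemLp (fun w => r w * u₀ w) 2 μ) (t : ℝ) :
    Tendsto (fun n : ℕ => (n : ℂ) * (∫ w, cexp ((t * (r w / √n) : ℝ) * I) ∂(sqMeasure μ (u n)) -
        ∫ w, cexp ((t * (r w / √n) : ℝ) * I) ∂(sqMeasure μ u₀))) atTop
      (𝓝 (t * (∫ w, r w * u₀ w * (2 * a w) ∂μ : ℝ) * I)) := by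
  set ρ : ℕ → S → ℝ := fun n w => √n * (u n w - u₀ w) - a w with hρ
  have hρL : ∀ n, MemLp (ρ n) 2 μ := hq.memLp_remainder
  have hρm : ∀ n, Measurable (ρ n) := fun n =>
    ((((hq.measurable_seq n).sub hq.measurable_base).const_mul _).sub hq.measurable_dir)
  have hu₀ := hq.measurable_base
  have ha := hq.measurable_dir
  have hum := hq.measurable_seq
  set e : ℕ → S → ℂ := fun n w => cexp ((t * r w / √n : ℝ) * I) - 1 with he
  have hem : ∀ n, Measurable (e n) := fun n => by fun_prop
  have he2 : ∀ n w, ‖e n w‖ ≤ 2 := fun n w => norm_exp_mul_I_sub_one_le_two _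
  have hes : ∀ (n : ℕ) w, ‖(√n : ℂ) * e n w‖ ≤ |t * r w| := fun n w =>
    norm_sqrt_mul_exp_sub_one_le _ _
  -- the three terms of the expansion
  have hIA : ∀ n : ℕ, Integrable (fun w => (√n : ℂ) * e n w * (2 * u₀ w * a w : ℝ)) μ := by
    intro n
    have : Integrable (fun w => 2 * u₀ w * a w) μ := by
      simpa [mul_assoc] using (hq.memLp_base.integrable_mul hq.memLp_dir).const_mul 2
    refine this.ofReal.bdd_mul (c := ‖(√n : ℂ)‖ * 2) (by fun_prop) (ae_of_all _ fun w => ?_)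
    rw [norm_mul]
    exact mul_le_mul_of_nonneg_left (he2 n w) (norm_nonneg _)
  have hIB : ∀ n : ℕ, Integrable (fun w => (√n : ℂ) * e n w * (2 * u₀ w * ρ n w : ℝ)) μ := by
    intro n
    have : Integrable (fun w => 2 * u₀ w * ρ n w) μ := by
      simpa [mul_assoc] using (hq.memLp_base.integrable_mul (hρL n)).const_mul 2
    refine this.ofReal.bdd_mul (c := ‖(√n : ℂ)‖ * 2) (by fun_prop) (ae_of_all _ fun w => ?_)
    rw [norm_mul]
    exact mul_le_mul_of_nonneg_left (he2 n w) (norm_nonneg _)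
  have hIC : ∀ n : ℕ, Integrable (fun w => e n w * ((a w + ρ n w) ^ 2 : ℝ)) μ := by
    intro n
    refine (hq.memLp_dir.add (hρL n)).integrable_sq.ofReal.bdd_mul (c := 2) (by fun_prop)
      (ae_of_all _ fun w => he2 n w)
  have hA : Tendsto (fun n : ℕ => ∫ w, (√n : ℂ) * e n w * (2 * u₀ w * a w : ℝ) ∂μ) atTop
      (𝓝 (∫ w, ((t * r w : ℝ) : ℂ) * I * (2 * u₀ w * a w : ℝ) ∂μ)) := by
    refine tendsto_integral_of_dominated_convergence
      (fun w => |t| * (|r w * u₀ w| * |2 * a w|)) (fun n => (hIA n).aestronglyMeasurable) ?_ ?_ ?_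
    · exact ((hru.abs.integrable_mul (hq.memLp_dir.const_mul 2).abs).const_mul _)
    · refine fun n => ae_of_all _ fun w => ?_
      rw [norm_mul, Complex.norm_real, Real.norm_eq_abs]
      refine (mul_le_mul_of_nonneg_right (hes n w) (abs_nonneg _)).trans_eq ?_
      simp only [abs_mul]
      ring
    · refine ae_of_all _ fun w => ?_
      exact (tendsto_sqrt_mul_exp_sub_one (t * r w)).mul_const _
  have hB : Tendsto (fun n : ℕ => ∫ w, (√n : ℂ) * e n w * (2 * u₀ w * ρ n w : ℝ) ∂μ) atTop
      (𝓝 0) := by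
    have hlim : Tendsto (fun n => 2 * |t| *
        (√(∫ w, (r w * u₀ w) ^ 2 ∂μ) * √(∫ w, ρ n w ^ 2 ∂μ))) atTop (𝓝 0) := by
      simpa using (hq.tendsto.sqrt.const_mul (√(∫ w, (r w * u₀ w) ^ 2 ∂μ))).const_mul (2 * |t|)
    refine squeeze_zero_norm (fun n => ?_) hlim
    refine (norm_integral_le_integral_norm _).trans ?_
    refine le_trans ?_ (mul_le_mul_of_nonneg_left
      (integral_abs_mul_abs_le_sqrt_mul_sqrt hru (hρL n)) (by positivity))
    rw [← integral_const_mul]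
    refine integral_mono (hIB n).norm ((hru.abs.integrable_mul (hρL n).abs).const_mul _)
      fun w => ?_
    simp only
    rw [norm_mul, Complex.norm_real, Real.norm_eq_abs]
    refine (mul_le_mul_of_nonneg_right (hes n w) (abs_nonneg _)).trans_eq ?_
    simp only [abs_mul, abs_two]
    ring
  have hC : Tendsto (fun n : ℕ => ∫ w, e n w * ((a w + ρ n w) ^ 2 : ℝ) ∂μ) atTop (𝓝 0) := by
    have hI1 : ∀ n, Integrable (fun w => ‖e n w‖ * (2 * a w ^ 2)) μ := fun n =>
      (hq.memLp_dir.integrable_sq.const_mul 2).bdd_mul (c := 2) (by fun_prop)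
        (ae_of_all _ fun w => by simpa using he2 n w)
    have h1 : Tendsto (fun n : ℕ => ∫ w, ‖e n w‖ * (2 * a w ^ 2) ∂μ) atTop (𝓝 0) := by
      rw [show (0 : ℝ) = ∫ _, (0 : ℝ) ∂μ by simp]
      refine tendsto_integral_of_dominated_convergence (fun w => 2 * (2 * a w ^ 2))
        (fun n => (hI1 n).aestronglyMeasurable)
        ((hq.memLp_dir.integrable_sq.const_mul 2).const_mul 2) ?_ ?_
      · refine fun n => ae_of_all _ fun w => ?_
        rw [Real.norm_of_nonneg (by positivity)]
        exact mul_le_mul_of_nonneg_right (he2 n w) (by positivity)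
      · refine ae_of_all _ fun w => ?_
        have h0 : Tendsto (fun n : ℕ => |t * r w / √n|) atTop (𝓝 0) := by
          simpa using (tendsto_div_sqrt_nat (t * r w)).abs
        have : Tendsto (fun n => ‖e n w‖) atTop (𝓝 0) :=
          squeeze_zero (fun _ => norm_nonneg _) (fun n => norm_exp_mul_I_sub_one_le_abs _) h0
        simpa using this.mul_const (2 * a w ^ 2)
    have hlim : Tendsto (fun n => ∫ w, ‖e n w‖ * (2 * a w ^ 2) ∂μ + 4 * ∫ w, ρ n w ^ 2 ∂μ) atTop
        (𝓝 0) := by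
      simpa using h1.add (hq.tendsto.const_mul 4)
    refine squeeze_zero_norm (fun n => ?_) hlim
    refine (norm_integral_le_integral_norm _).trans ?_
    rw [← integral_const_mul, ← integral_add (hI1 n) ((hρL n).integrable_sq.const_mul 4)]
    refine integral_mono (hIC n).norm ((hI1 n).add ((hρL n).integrable_sq.const_mul 4))
      fun w => ?_
    simp only
    rw [norm_mul, Complex.norm_real, Real.norm_of_nonneg (sq_nonneg _)]
    nlinarith [he2 n w, norm_nonneg (e n w), sq_nonneg (a w - ρ n w), sq_nonneg (ρ n w),
      mul_nonneg (norm_nonneg (e n w)) (sq_nonneg (a w - ρ n w)),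
      mul_nonneg (sub_nonneg.2 (he2 n w)) (sq_nonneg (ρ n w))]
  have hlimit : (∫ w, ((t * r w : ℝ) : ℂ) * I * (2 * u₀ w * a w : ℝ) ∂μ)
      = t * (∫ w, r w * u₀ w * (2 * a w) ∂μ : ℝ) * I := by
    rw [← integral_complex_ofReal, ← integral_const_mul, ← integral_mul_const]
    refine integral_congr_ae (ae_of_all _ fun w => ?_)
    push_cast
    ring
  have hsum := (hA.add hB).add hC
  rw [hlimit, add_zero, add_zero] at hsum
  refine hsum.congr fun n => ?_
  have hAB := (hIA n).add (hIB n)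
  simp only [Pi.add_def] at hAB
  rw [← integral_add (hIA n) (hIB n), ← integral_add hAB (hIC n),
    integral_sqMeasure (hum n), integral_sqMeasure hu₀]
  have hI1 : ∀ v : S → ℝ, MemLp v 2 μ →
      Integrable (fun w => v w ^ 2 • cexp ((t * (r w / √n) : ℝ) * I)) μ := by
    intro v hv
    have := hv.integrable_sq.ofReal (𝕜 := ℂ)
    have h2 := this.bdd_mul (f := fun w => cexp ((t * (r w / √n) : ℝ) * I)) (c := 1)
      (by fun_prop) (ae_of_all _ fun w => by rw [norm_exp_ofReal_mul_I])
    refine h2.congr (ae_of_all _ fun w => ?_)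
    simp only [Complex.real_smul]
    rw [mul_comm]
    simp
  have hone : ∫ w, (((u n w ^ 2 - u₀ w ^ 2 : ℝ)) : ℂ) ∂μ = 0 := by
    rw [integral_complex_ofReal, integral_sub (hq.memLp_seq n).integrable_sq
      hq.memLp_base.integrable_sq, hq.integral_seq, hq.integral_base]
    simp
  have hdiff : Integrable (fun w => (((u n w ^ 2 - u₀ w ^ 2 : ℝ)) : ℂ)) μ :=
    ((hq.memLp_seq n).integrable_sq.sub hq.memLp_base.integrable_sq).ofReal
  have hI2 := (hI1 _ (hq.memLp_seq n)).sub (hI1 _ hq.memLp_base)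
  simp only [Pi.sub_def] at hI2
  have hkey : ∫ w, u n w ^ 2 • cexp ((t * (r w / √n) : ℝ) * I) ∂μ -
      ∫ w, u₀ w ^ 2 • cexp ((t * (r w / √n) : ℝ) * I) ∂μ =
      ∫ w, ((u n w ^ 2 - u₀ w ^ 2 : ℝ) : ℂ) * e n w ∂μ := by
    rw [← integral_sub (hI1 _ (hq.memLp_seq n)) (hI1 _ hq.memLp_base),
      ← sub_zero (∫ w, (u n w ^ 2 • _ - _) ∂μ), ← hone,
      ← integral_sub hI2 hdiff]
    refine integral_congr_ae (ae_of_all _ fun w => ?_)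
    simp only [he, Complex.real_smul, mul_div_assoc]
    push_cast
    ring
  rw [hkey, ← integral_const_mul]
  refine integral_congr_ae (ae_of_all _ fun w => ?_)
  have hn : ((√n : ℝ) : ℂ) ^ 2 = n := by
    rw [← Complex.ofReal_pow, Real.sq_sqrt (Nat.cast_nonneg n), Complex.ofReal_natCast]
  simp only [hρ]
  rw [← hn]
  push_cast
  ring

/-- Convergence of characteristic functions implies convergence of the measures of continuity
sets of the limit. -/
lemma tendsto_real_of_tendsto_charFun {E : Type*} [NormedAddCommGroup E] [InnerProductSpace ℝ E]
    [FiniteDimensional ℝ E] [MeasurableSpace E] [BorelSpace E] {ν : ℕ → Measure E} {ν₀ : Measure E}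
    [∀ n, IsProbabilityMeasure (ν n)] [IsProbabilityMeasure ν₀]
    (h : ∀ t, Tendsto (fun n => charFun (ν n) t) atTop (𝓝 (charFun ν₀ t)))
    {A : Set E} (hA : ν₀ (frontier A) = 0) :
    Tendsto (fun n => (ν n).real A) atTop (𝓝 (ν₀.real A)) := by
  let νs : ℕ → ProbabilityMeasure E := fun n => ⟨ν n, inferInstance⟩
  let νl : ProbabilityMeasure E := ⟨ν₀, inferInstance⟩
  have h1 : Tendsto νs atTop (𝓝 νl) := ProbabilityMeasure.tendsto_of_tendsto_charFun h
  have h2 := ProbabilityMeasure.tendsto_measure_of_null_frontier_of_tendsto' h1 hA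
  exact (ENNReal.tendsto_toReal (measure_ne_top ν₀ A)).comp h2

/-- The local asymptotic distribution of a normalized sum: along a quadratic mean differentiable
sequence, the null limit `N(0, σ²)` is shifted by the covariance of the summand with the score. -/
lemma IsQMDSeq.tendsto_real_sum_div_sqrt (hq : IsQMDSeq μ u₀ u a) {r : S → ℝ}
    (hr : Measurable r) (hr2 : MemLp r 2 (sqMeasure μ u₀)) (h0 : ∫ w, r w ∂(sqMeasure μ u₀) = 0)
    {v : NNReal} (hv : ∫ w, r w ^ 2 ∂(sqMeasure μ u₀) = v) {m : ℝ}
    (hm : ∫ w, r w * u₀ w * (2 * a w) ∂μ = m) {A : Set ℝ} (hA : MeasurableSet A)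
    (hA0 : gaussianReal m v (frontier A) = 0) :
    Tendsto (fun n : ℕ => (iidLaw (sqMeasure μ (u n)) n).real {w | (∑ i, r (w i)) / √n ∈ A}) atTop
      (𝓝 ((gaussianReal m v).real A)) := by
  have hP : IsProbabilityMeasure (sqMeasure μ u₀) :=
    isProbabilityMeasure_sqMeasure hq.memLp_base hq.integral_base
  have hQ : ∀ n, IsProbabilityMeasure (sqMeasure μ (u n)) := fun n =>
    isProbabilityMeasure_sqMeasure (hq.memLp_seq n) (hq.integral_seq n)
  have hQn : ∀ n, IsProbabilityMeasure (iidLaw (sqMeasure μ (u n)) n) := fun n => by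
    unfold iidLaw; infer_instance
  have hmeas : ∀ n : ℕ, Measurable fun w : Fin n → S => (∑ i, r (w i)) / √n := fun n =>
    (Finset.univ.measurable_fun_sum fun i _ => hr.comp (measurable_pi_apply i)).div_const _
  have : ∀ n : ℕ, IsProbabilityMeasure
      ((iidLaw (sqMeasure μ (u n)) n).map fun w => (∑ i, r (w i)) / √n) := fun n =>
    Measure.isProbabilityMeasure_map (hmeas n).aemeasurable
  have hchar : ∀ t : ℝ, Tendsto (fun n : ℕ => charFun
      ((iidLaw (sqMeasure μ (u n)) n).map fun w => (∑ i, r (w i)) / √n) t) atTop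
      (𝓝 (charFun (gaussianReal m v) t)) := by
    intro t
    have h1 := tendsto_nat_mul_integral_exp_sub_one (sqMeasure μ u₀) hr hr2 h0 t
    have h2 := hq.tendsto_nat_mul_integral_exp_sub hr
      (memLp_two_mul_of_memLp_sqMeasure hq.measurable_base hr hr2) t
    have h3 : Tendsto (fun n : ℕ => (n : ℂ) *
        (∫ w, cexp ((t * (r w / √n) : ℝ) * I) ∂(sqMeasure μ (u n)) - 1)) atTop
        (𝓝 (t * m * I - v * t ^ 2 / 2)) := by
      have h4 := h2.add h1
      rw [hm, hv] at h4
      refine (h4.congr fun n => by ring).trans_eq ?_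
      congr 1
      ring
    have h5 := Complex.tendsto_one_add_pow_exp_of_tendsto h3
    rw [charFun_gaussianReal]
    refine h5.congr fun n => ?_
    rw [charFun_map_sum_div_sqrt _ hr]
    ring
  have key := tendsto_real_of_tendsto_charFun hchar hA0
  refine key.congr fun n => ?_
  rw [map_measureReal_apply (hmeas n) hA]
  rfl

end CharFun

/-! ### Contiguity -/

section Contiguity

variable {S : Type*} [MeasurableSpace S] {μ : Measure S}

/-- The direction of a quadratic mean differentiable sequence is approximated in `L²(μ)` by
multiples of the base half-density with bounded factor. -/
lemma IsQMDSeq.exists_bounded_approx {u₀ : S → ℝ} {u : ℕ → S → ℝ} {a : S → ℝ}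
    (hq : IsQMDSeq μ u₀ u a) {δ : ℝ} (hδ : 0 < δ) :
    ∃ g : S → ℝ, Measurable g ∧ (∃ M : ℝ, 0 ≤ M ∧ ∀ w, |g w| ≤ M) ∧
      ∫ w, (a w - u₀ w * g w) ^ 2 ∂μ < δ := by
  have hu₀ := hq.measurable_base
  have ha := hq.measurable_dir
  set g : ℕ → S → ℝ := fun k w => if |a w / u₀ w| ≤ k then a w / u₀ w else 0 with hg
  have hgm : ∀ k, Measurable (g k) := fun k =>
    Measurable.ite (measurableSet_le (by fun_prop) (by fun_prop)) (by fun_prop) (by fun_prop)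
  have hlim : Tendsto (fun k => ∫ w, (a w - u₀ w * g k w) ^ 2 ∂μ) atTop (𝓝 0) := by
    rw [show (0 : ℝ) = ∫ _, (0 : ℝ) ∂μ by simp]
    refine tendsto_integral_of_dominated_convergence (fun w => a w ^ 2)
      (fun n => by have := hgm n; exact Measurable.aestronglyMeasurable (by fun_prop))
      hq.memLp_dir.integrable_sq ?_ ?_
    · refine fun k => ae_of_all _ fun w => ?_
      rw [Real.norm_of_nonneg (sq_nonneg _)]
      by_cases h0 : u₀ w = 0
      · simp [h0]
      · by_cases hk : |a w / u₀ w| ≤ k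
        · simp [hg, hk, mul_div_cancel₀ _ h0, sq_nonneg]
        · simp [hg, hk]
    · filter_upwards [hq.dir_eq_zero] with w hw
      refine tendsto_const_nhds.congr' ?_
      obtain ⟨N, hN⟩ := exists_nat_ge |a w / u₀ w|
      filter_upwards [eventually_ge_atTop N] with k hk
      have hk' : |a w / u₀ w| ≤ k := hN.trans (by exact_mod_cast hk)
      by_cases h0 : u₀ w = 0
      · simp [h0, hw h0]
      · simp [hg, hk', mul_div_cancel₀ _ h0]
  obtain ⟨k, hk⟩ := (hlim.eventually_lt_const hδ).exists
  refine ⟨g k, hgm k, ⟨k, by positivity, fun w => ?_⟩, hk⟩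
  by_cases h : |a w / u₀ w| ≤ k
  · simp [hg, h]
  · simp [hg, h]

variable [SigmaFinite μ]

lemma memLp_prod_eval {u : S → ℝ} (hu : Measurable u) (hu2 : MemLp u 2 μ) (n : ℕ) :
    MemLp (fun w : Fin n → S => ∏ i, u (w i)) 2 (Measure.pi fun _ => μ) := by
  rw [memLp_two_iff_integrable_sq]
  · simp only [← Finset.prod_pow]
    exact Integrable.fintype_prod (f := fun _ x => u x ^ 2) fun _ => hu2.integrable_sq
  · exact (Finset.univ.measurable_fun_prod fun i _ =>
      hu.comp (measurable_pi_apply i)).aestronglyMeasurable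

/-- The half-density of an i.i.d. sample is the product of the half-densities. -/
lemma iidLaw_sqMeasure {u : S → ℝ} (hu2 : MemLp u 2 μ)
    [IsFiniteMeasure (sqMeasure μ u)] (n : ℕ) :
    iidLaw (sqMeasure μ u) n =
      sqMeasure (Measure.pi fun _ : Fin n => μ) (fun w => ∏ i, u (w i)) := by
  refine Measure.pi_eq fun s hs => ?_
  have hI : ∀ i, Integrable (fun x => u x ^ 2) (μ.restrict (s i)) := fun i =>
    hu2.integrable_sq.restrict
  rw [sqMeasure, withDensity_apply _ (MeasurableSet.univ_pi hs), Measure.restrict_pi_pi]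
  simp only [← Finset.prod_pow]
  rw [← ofReal_integral_eq_lintegral_ofReal
    (Integrable.fintype_prod (f := fun _ x => u x ^ 2) hI)
    (ae_of_all _ fun _ => Finset.prod_nonneg fun _ _ => sq_nonneg _),
    integral_fintype_prod_eq_prod (fun _ x => u x ^ 2),
    ENNReal.ofReal_prod_of_nonneg fun i _ => integral_nonneg fun _ => sq_nonneg _]
  refine Finset.prod_congr rfl fun i _ => ?_
  rw [sqMeasure, withDensity_apply _ (hs i),
    ofReal_integral_eq_lintegral_ofReal (hI i) (ae_of_all _ fun _ => sq_nonneg _)]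

/-- Changing the half-density of an i.i.d. sample changes the expectation of a test by at most
a multiple of the squared Hellinger distance `2 - 2 (∫ u v)ⁿ` of the product laws. -/
lemma integral_iidLaw_le_of_overlap {u v : S → ℝ} (hu : Measurable u) (hv : Measurable v)
    (hu2 : MemLp u 2 μ) (hv2 : MemLp v 2 μ) (hu1 : ∫ w, u w ^ 2 ∂μ = 1)
    (hv1 : ∫ w, v w ^ 2 ∂μ = 1) {n : ℕ} {f : (Fin n → S) → ℝ} (hf : Measurable f)
    (hf01 : ∀ w, f w ∈ Set.Icc (0 : ℝ) 1) :
    ∫ w, f w ∂(iidLaw (sqMeasure μ u) n) ≤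
      2 * (2 - 2 * (∫ w, u w * v w ∂μ) ^ n) + 2 * ∫ w, f w ∂(iidLaw (sqMeasure μ v) n) := by
  have := isProbabilityMeasure_sqMeasure hu2 hu1
  have := isProbabilityMeasure_sqMeasure hv2 hv1
  have hUm : ∀ {u : S → ℝ}, Measurable u → Measurable fun w : Fin n → S => ∏ i, u (w i) :=
    fun h => Finset.univ.measurable_fun_prod fun i _ => h.comp (measurable_pi_apply i)
  have hU := memLp_prod_eval hu hu2 n
  have hV := memLp_prod_eval hv hv2 n
  have hnorm : ∀ u : S → ℝ, ∫ w, u w ^ 2 ∂μ = 1 →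
      ∫ w : Fin n → S, (∏ i, u (w i)) ^ 2 ∂(Measure.pi fun _ => μ) = 1 := by
    intro u h
    simp only [← Finset.prod_pow]
    rw [integral_fintype_prod_eq_pow (fun x => u x ^ 2), h, one_pow]
  have hov : ∫ w : Fin n → S, (∏ i, u (w i)) * ∏ i, v (w i) ∂(Measure.pi fun _ => μ) =
      (∫ w, u w * v w ∂μ) ^ n := by
    simp only [← Finset.prod_mul_distrib]
    rw [integral_fintype_prod_eq_pow (fun x => u x * v x), Fintype.card_fin]
  rw [iidLaw_sqMeasure hu2, iidLaw_sqMeasure hv2, integral_sqMeasure (hUm hu),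
    integral_sqMeasure (hUm hv)]
  set U : (Fin n → S) → ℝ := fun w => ∏ i, u (w i) with hUdef
  set V : (Fin n → S) → ℝ := fun w => ∏ i, v (w i) with hVdef
  have hfI : ∀ {U : (Fin n → S) → ℝ}, MemLp U 2 (Measure.pi fun _ => μ) →
      Integrable (fun w => U w ^ 2 • f w) (Measure.pi fun _ => μ) := fun hU =>
    hU.integrable_sq.mul_bdd (c := 1) hf.aestronglyMeasurable (ae_of_all _ fun w => by
      rw [Real.norm_of_nonneg (hf01 w).1]; exact (hf01 w).2)
  have hUV : Integrable (fun w => U w * V w) (Measure.pi fun _ => μ) := hU.integrable_mul hV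
  have hsub : ∫ w, (U w - V w) ^ 2 ∂(Measure.pi fun _ => μ) =
      2 - 2 * (∫ w, u w * v w ∂μ) ^ n := by
    have e : ∀ w, (U w - V w) ^ 2 = U w ^ 2 - 2 * (U w * V w) + V w ^ 2 := fun w => by ring
    simp only [e]
    have hI := hU.integrable_sq.sub (hUV.const_mul 2)
    simp only [Pi.sub_def] at hI
    rw [integral_add hI hV.integrable_sq,
      integral_sub hU.integrable_sq (hUV.const_mul 2), integral_const_mul, hnorm u hu1, hnorm v hv1,
      hov]
    ring
  have hsubI : Integrable (fun w => (U w - V w) ^ 2) (Measure.pi fun _ => μ) :=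
    (hU.sub hV).integrable_sq
  rw [← hsub, ← integral_const_mul, ← integral_const_mul,
    ← integral_add (hsubI.const_mul 2) ((hfI hV).const_mul 2)]
  refine integral_mono (hfI hU) ((hsubI.const_mul 2).add ((hfI hV).const_mul 2)) fun w => ?_
  simp only [smul_eq_mul]
  nlinarith [mul_nonneg (hf01 w).1 (sq_nonneg (U w - 2 * V w)),
    mul_nonneg (sub_nonneg.2 (hf01 w).2) (sq_nonneg (U w - V w))]

/-- The expectation of a test under a product law with bounded relative density is controlled by
its null expectation and the second moment of the likelihood ratio. -/
lemma integral_iidLaw_mul_le {u ℓ : S → ℝ} (hu : Measurable u) (hℓ : Measurable ℓ)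
    (hu2 : MemLp u 2 μ) (hu1 : ∫ w, u w ^ 2 ∂μ = 1) {C : ℝ} (hC : ∀ w, |ℓ w| ≤ C)
    (h1 : ∫ w, (u w * ℓ w) ^ 2 ∂μ = 1) {n : ℕ} {f : (Fin n → S) → ℝ} (hf : Measurable f)
    (hf01 : ∀ w, f w ∈ Set.Icc (0 : ℝ) 1) :
    ∫ w, f w ∂(iidLaw (sqMeasure μ fun w => u w * ℓ w) n) ≤
      √(∫ w, f w ∂(iidLaw (sqMeasure μ u) n)) *
        √((∫ w, (ℓ w ^ 2) ^ 2 ∂(sqMeasure μ u)) ^ n) := by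
  have hul2 : MemLp (fun w => u w * ℓ w) 2 μ := by
    refine (hu2.const_mul C).mono (hu.mul hℓ).aestronglyMeasurable (ae_of_all _ fun w => ?_)
    have hC0 : 0 ≤ C := (abs_nonneg _).trans (hC w)
    simp only [norm_mul, Real.norm_eq_abs, abs_of_nonneg hC0]
    rw [mul_comm]
    exact mul_le_mul_of_nonneg_right (hC w) (abs_nonneg _)
  have := isProbabilityMeasure_sqMeasure hul2 h1
  have := isProbabilityMeasure_sqMeasure hu2 hu1
  have hprob : IsProbabilityMeasure (iidLaw (sqMeasure μ u) n) := by
    unfold iidLaw; infer_instance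
  have hUm : ∀ {u : S → ℝ}, Measurable u → Measurable fun w : Fin n → S => ∏ i, u (w i) :=
    fun h => Finset.univ.measurable_fun_prod fun i _ => h.comp (measurable_pi_apply i)
  have e1 : ∫ w, f w ∂(iidLaw (sqMeasure μ fun w => u w * ℓ w) n) =
      ∫ w, |f w| * |∏ i, ℓ (w i) ^ 2| ∂(iidLaw (sqMeasure μ u) n) := by
    have hul : Measurable fun w => u w * ℓ w := hu.mul hℓ
    rw [iidLaw_sqMeasure hul2, iidLaw_sqMeasure hu2,
      integral_sqMeasure (hUm hul), integral_sqMeasure (hUm hu)]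
    refine integral_congr_ae (ae_of_all _ fun w => ?_)
    simp only [Finset.prod_mul_distrib, smul_eq_mul, Finset.prod_pow]
    rw [abs_of_nonneg (hf01 w).1, abs_of_nonneg (sq_nonneg _)]
    ring
  have hfb : ∀ w, ‖f w‖ ≤ 1 := fun w => by
    rw [Real.norm_of_nonneg (hf01 w).1]; exact (hf01 w).2
  have hf2 : MemLp f 2 (iidLaw (sqMeasure μ u) n) :=
    MemLp.of_bound hf.aestronglyMeasurable 1 (ae_of_all _ hfb)
  have hL2 : MemLp (fun w : Fin n → S => ∏ i, ℓ (w i) ^ 2) 2 (iidLaw (sqMeasure μ u) n) := by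
    refine MemLp.of_bound (hUm (hℓ.pow_const 2)).aestronglyMeasurable (∏ _i : Fin n, C ^ 2)
      (ae_of_all _ fun w => ?_)
    rw [Real.norm_eq_abs, abs_of_nonneg (Finset.prod_nonneg fun _ _ => sq_nonneg _)]
    refine Finset.prod_le_prod (fun _ _ => sq_nonneg _) fun i _ => ?_
    rw [← sq_abs]
    exact pow_le_pow_left₀ (abs_nonneg _) (hC _) 2
  rw [e1]
  refine (integral_abs_mul_abs_le_sqrt_mul_sqrt hf2 hL2).trans ?_
  refine mul_le_mul (Real.sqrt_le_sqrt ?_) (Real.sqrt_le_sqrt (le_of_eq ?_))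
    (Real.sqrt_nonneg _) (Real.sqrt_nonneg _)
  · refine integral_mono hf2.integrable_sq (hf2.integrable (by norm_num)) fun w => ?_
    simp only
    nlinarith [(hf01 w).1, (hf01 w).2]
  · simp only [← Finset.prod_pow]
    rw [iidLaw, integral_fintype_prod_eq_pow (fun x => (ℓ x ^ 2) ^ 2), Fintype.card_fin]

lemma abs_one_add_div_sq_sub_one_le {x M q : ℝ} (hx : |x| ≤ M) (hq : 1 ≤ q) :
    |(1 + x / q) ^ 2 - 1| ≤ (2 * M + M ^ 2) / q := by
  have hq0 : 0 < q := by linarith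
  have hy : |x / q| ≤ M / q := by
    rw [abs_div, abs_of_pos hq0]
    gcongr
  have hM : 0 ≤ M := (abs_nonneg _).trans hx
  have e : (1 + x / q) ^ 2 - 1 = 2 * (x / q) + (x / q) ^ 2 := by ring
  rw [e]
  refine (abs_add_le _ _).trans ?_
  rw [abs_mul, abs_two, abs_pow, add_div]
  refine add_le_add ?_ ?_
  · rw [mul_div_assoc]
    gcongr
  · refine (pow_le_pow_left₀ (abs_nonneg _) hy 2).trans ?_
    rw [div_pow]
    gcongr
    nlinarith

/-- At a fixed sample size, the expectation of a test under the perturbed law is bounded by its null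
expectation. The comparison law has half-density proportional to `u₀ (1 + g / √n)` with `g` bounded
by `M`; the error is controlled by the `L²` distance of `√n (u - u₀)` to `u₀ g`. -/
lemma integral_iidLaw_le_of_bounded_approx {u₀ u g : S → ℝ} (hu₀ : Measurable u₀)
    (hu : Measurable u) (hg : Measurable g) (hu₀2 : MemLp u₀ 2 μ) (hu2 : MemLp u 2 μ)
    (hu₀1 : ∫ w, u₀ w ^ 2 ∂μ = 1) (hu1 : ∫ w, u w ^ 2 ∂μ = 1) {M : ℝ} (hM : ∀ w, |g w| ≤ M)
    {n : ℕ} (hn : 1 ≤ n) (hs : (2 * M + M ^ 2) / √n ≤ 1 / 2) {κ : ℝ} (hκ1 : κ ≤ 1)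
    (hκ : ∫ w, (√n * (u w - u₀ w) - u₀ w * g w) ^ 2 ∂μ ≤ κ)
    {f : (Fin n → S) → ℝ} (hf : Measurable f) (hf01 : ∀ w, f w ∈ Set.Icc (0 : ℝ) 1) :
    ∫ w, f w ∂(iidLaw (sqMeasure μ u) n) ≤
      4 * κ + 2 * (√(∫ w, f w ∂(iidLaw (sqMeasure μ u₀) n)) *
        √(Real.exp (16 * (2 * M + M ^ 2) ^ 2))) := by
  have hn0 : (0 : ℝ) < n := by exact_mod_cast hn
  have hq1 : 1 ≤ √(n : ℝ) := Real.one_le_sqrt.2 (by exact_mod_cast hn)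
  have hq0 : 0 < √(n : ℝ) := by linarith
  have hqq : √(n : ℝ) ^ 2 = n := Real.sq_sqrt hn0.le
  have hP := isProbabilityMeasure_sqMeasure hu₀2 hu₀1
  have hκ0 : 0 ≤ κ := (integral_nonneg fun _ => sq_nonneg _).trans hκ
  set s : ℝ := (2 * M + M ^ 2) / √n with hsdef
  set b : S → ℝ := fun w => 1 + g w / √n with hb
  have hbm : Measurable b := by fun_prop
  have hbs : ∀ w, |b w ^ 2 - 1| ≤ s := fun w => abs_one_add_div_sq_sub_one_le (hM w) hq1
  have hbb : ∀ w, |b w| ≤ 2 := fun w => by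
    refine abs_le_of_sq_le_sq ?_ (by norm_num)
    have := (abs_le.1 (hbs w)).2
    nlinarith
  set m : ℝ := ∫ w, b w ^ 2 ∂(sqMeasure μ u₀) with hm
  have hb2I : Integrable (fun w => b w ^ 2) (sqMeasure μ u₀) :=
    Integrable.of_bound (by fun_prop) 4 (ae_of_all _ fun w => by
      rw [Real.norm_of_nonneg (sq_nonneg _), ← sq_abs]
      nlinarith [hbb w, abs_nonneg (b w)])
  -- `m` is the squared norm of `u₀ b`; dividing by `√m` gives the comparison half-density `u₀ ℓ`
  have hm1 : |m - 1| ≤ s := by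
    have : m - 1 = ∫ w, (b w ^ 2 - 1) ∂(sqMeasure μ u₀) := by
      rw [integral_sub hb2I (integrable_const _)]
      simp [hm]
    rw [this]
    refine (norm_integral_le_of_norm_le_const (μ := sqMeasure μ u₀)
      (f := fun w => b w ^ 2 - 1) (C := s)
      (ae_of_all _ hbs)).trans ?_
    simp
  have hml := (abs_le.1 hm1).1
  have hm0 : 0 < m := by linarith
  have hmq : 1 / 2 ≤ √m := Real.le_sqrt_of_sq_le (by linarith)
  have hmq0 : 0 < √m := by linarith
  have hmm : √m ^ 2 = m := Real.sq_sqrt hm0.le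
  set ℓ : S → ℝ := fun w => b w / √m with hℓ
  have hℓm : Measurable ℓ := by fun_prop
  have hℓb : ∀ w, |ℓ w| ≤ 2 / √m := fun w => by
    rw [hℓ, abs_div, abs_of_pos hmq0]
    gcongr
    exact hbb w
  have hbu : ∫ w, (u₀ w * b w) ^ 2 ∂μ = m := by
    rw [hm, integral_sqMeasure hu₀]
    refine integral_congr_ae (ae_of_all _ fun w => ?_)
    simp only [smul_eq_mul]
    ring
  have hbuL : MemLp (fun w => u₀ w * b w) 2 μ := by
    refine (hu₀2.const_mul 2).mono (hu₀.mul hbm).aestronglyMeasurable (ae_of_all _ fun w => ?_)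
    simp only [norm_mul, Real.norm_eq_abs, abs_two]
    rw [mul_comm]
    exact mul_le_mul_of_nonneg_right (hbb w) (abs_nonneg _)
  have huℓ : ∀ w, u₀ w * ℓ w = (√m)⁻¹ * (u₀ w * b w) := fun w => by
    simp only [hℓ, div_eq_mul_inv]
    ring
  have huℓL : MemLp (fun w => u₀ w * ℓ w) 2 μ := by
    simp only [huℓ]
    exact hbuL.const_mul _
  have huℓ1 : ∫ w, (u₀ w * ℓ w) ^ 2 ∂μ = 1 := by
    simp only [huℓ, mul_pow, integral_const_mul, inv_pow]
    simp only [← mul_pow]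
    rw [hbu, hmm, inv_mul_cancel₀ hm0.ne']
  -- the overlap of the two half-densities
  set c : ℝ := ∫ w, u w * (u₀ w * ℓ w) ∂μ with hc
  have hcm : ∫ w, u w * (u₀ w * b w) ∂μ = √m * c := by
    rw [hc, ← integral_const_mul]
    refine integral_congr_ae (ae_of_all _ fun w => ?_)
    simp only [huℓ]
    field_simp
  -- the squared `L²` distance between `√n u` and `√n u₀ b`, in terms of the norm `√m` of `u₀ b`
  -- and the overlap `c`; both terms are nonnegative, which bounds `n (1 - c)`
  have hident : ∫ w, (√n * (u w - u₀ w) - u₀ w * g w) ^ 2 ∂μ =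
      n * ((1 - √m) ^ 2 + 2 * √m * (1 - c)) := by
    have e : ∀ w, (√n * (u w - u₀ w) - u₀ w * g w) ^ 2 =
        n * (u w ^ 2 - 2 * (u w * (u₀ w * b w)) + (u₀ w * b w) ^ 2) := fun w => by
      have : √n * (u w - u₀ w) - u₀ w * g w = √n * (u w - u₀ w * b w) := by
        simp only [hb]
        field_simp
        ring
      rw [this, mul_pow, hqq]
      ring
    simp only [e]
    have hI0 : Integrable (fun w => 2 * (u w * (u₀ w * b w))) μ :=
      (hu2.integrable_mul hbuL).const_mul 2
    have hI := hu2.integrable_sq.sub hI0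
    simp only [Pi.sub_def] at hI
    rw [integral_const_mul, integral_add hI hbuL.integrable_sq,
      integral_sub hu2.integrable_sq hI0,
      integral_const_mul, hu1, hbu, hcm]
    congr 1
    linear_combination (-1 : ℝ) * hmm
  have hnc : n * (1 - c) ≤ κ := by
    by_cases h1 : 0 ≤ 1 - c
    · refine le_trans ?_ hκ
      rw [hident]
      refine mul_le_mul_of_nonneg_left ?_ hn0.le
      nlinarith [sq_nonneg (1 - √m), mul_nonneg h1 (sub_nonneg.2 hmq)]
    · exact (mul_nonpos_of_nonneg_of_nonpos hn0.le (not_le.1 h1).le).trans hκ0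
  -- Bernoulli's inequality turns this into a bound on the overlap of the product laws
  have hcpow : 1 - κ ≤ c ^ n := by
    have hc2 : -2 ≤ c - 1 := by
      have hn1 : (1 : ℝ) ≤ n := by exact_mod_cast hn
      by_contra hcon
      nlinarith
    have h := one_add_mul_le_pow hc2 n
    rw [add_sub_cancel] at h
    linarith
  -- the second moment of the likelihood ratio
  have hL : ∫ w, (ℓ w ^ 2) ^ 2 ∂(sqMeasure μ u₀) ≤ 1 + 16 * (2 * M + M ^ 2) ^ 2 / n := by
    have hℓ2 : ∀ w, ℓ w ^ 2 = b w ^ 2 / m := fun w => by simp only [hℓ]; rw [div_pow, hmm]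
    have hLs : ∀ w, |ℓ w ^ 2 - 1| ≤ 4 * s := fun w => by
      have h2 : ℓ w ^ 2 - 1 = (b w ^ 2 - m) / m := by rw [hℓ2]; field_simp
      rw [h2, abs_div, abs_of_pos hm0, div_le_iff₀ hm0]
      have h3 : |b w ^ 2 - m| ≤ 2 * s := by
        have h4 := abs_sub_le (b w ^ 2) 1 m
        rw [abs_sub_comm 1 m] at h4
        linarith [hbs w]
      have hs0 : 0 ≤ s := (abs_nonneg _).trans (hbs w)
      nlinarith
    have hℓI : Integrable (fun w => ℓ w ^ 2) (sqMeasure μ u₀) := by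
      simp only [hℓ2]
      exact hb2I.div_const _
    -- `(ℓ² - 1)² ≤ 16 s²` and `ℓ²` has mean one, so the second moment is `1 + O(1 / n)`
    have hmean : ∫ w, (2 * ℓ w ^ 2 - 1 + 16 * s ^ 2) ∂(sqMeasure μ u₀) = 1 + 16 * s ^ 2 := by
      have hI := (hℓI.const_mul 2).sub (integrable_const (1 : ℝ))
      simp only [Pi.sub_def] at hI
      rw [integral_add hI (integrable_const _), integral_sub (hℓI.const_mul 2)
        (integrable_const _), integral_const_mul]
      have : ∫ w, ℓ w ^ 2 ∂(sqMeasure μ u₀) = 1 := by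
        simp only [hℓ2, integral_div]
        rw [← hm, div_self hm0.ne']
      rw [this]
      simp
      norm_num
    have hs2 : 16 * s ^ 2 = 16 * (2 * M + M ^ 2) ^ 2 / n := by
      rw [hsdef, div_pow, hqq, mul_div_assoc]
    rw [← hs2, ← hmean]
    refine integral_mono_of_nonneg (ae_of_all _ fun _ => sq_nonneg _) ?_ (ae_of_all _ fun w => ?_)
    · exact ((hℓI.const_mul 2).sub (integrable_const _)).add (integrable_const _)
    · have := sq_le_sq' (abs_le.1 (hLs w)).1 (abs_le.1 (hLs w)).2
      simp only
      nlinarith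
  have hexp : (∫ w, (ℓ w ^ 2) ^ 2 ∂(sqMeasure μ u₀)) ^ n ≤
      Real.exp (16 * (2 * M + M ^ 2) ^ 2) := by
    refine (pow_le_pow_left₀ (integral_nonneg fun _ => sq_nonneg _)
      (hL.trans ((add_comm _ _).trans_le (Real.add_one_le_exp _))) n).trans_eq ?_
    rw [← Real.exp_nat_mul, mul_div_cancel₀ _ hn0.ne']
  have hmain := integral_iidLaw_le_of_overlap hu (hu₀.mul hℓm) hu2 huℓL hu1 huℓ1 hf hf01
  have hsec := integral_iidLaw_mul_le hu₀ hℓm hu₀2 hu₀1 hℓb huℓ1 hf hf01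
  have hsec2 := hsec.trans (mul_le_mul_of_nonneg_left (Real.sqrt_le_sqrt hexp) (Real.sqrt_nonneg _))
  have hmain2 : ∫ w, f w ∂(iidLaw (sqMeasure μ u) n) ≤ 2 * (2 - 2 * c ^ n) +
      2 * ∫ w, f w ∂(iidLaw (sqMeasure μ fun w => u₀ w * ℓ w) n) := hmain
  linarith

/-- **Contiguity**: tests whose null expectation vanishes asymptotically also have vanishing
expectation along a quadratic mean differentiable sequence. -/
theorem IsQMDSeq.tendsto_integral_zero {u₀ : S → ℝ} {u : ℕ → S → ℝ} {a : S → ℝ}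
    (hq : IsQMDSeq μ u₀ u a) {f : ∀ n : ℕ, (Fin n → S) → ℝ} (hf : ∀ n, Measurable (f n))
    (hf01 : ∀ n w, f n w ∈ Set.Icc (0 : ℝ) 1)
    (h0 : Tendsto (fun n => ∫ w, f n w ∂(iidLaw (sqMeasure μ u₀) n)) atTop (𝓝 0)) :
    Tendsto (fun n => ∫ w, f n w ∂(iidLaw (sqMeasure μ (u n)) n)) atTop (𝓝 0) := by
  rw [tendsto_order]
  refine ⟨fun b hb => Eventually.of_forall fun n =>
    hb.trans_le (integral_nonneg fun w => (hf01 n w).1), fun ε hε => ?_⟩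
  have hδ : 0 < min (ε / 32) (1 / 4) := lt_min (by positivity) (by norm_num)
  set δ := min (ε / 32) (1 / 4) with hδdef
  obtain ⟨g, hg, ⟨M, hM0, hM⟩, hgδ⟩ := hq.exists_bounded_approx hδ
  have hgL : MemLp (fun w => u₀ w * g w) 2 μ := by
    refine (hq.memLp_base.const_mul M).mono (hq.measurable_base.mul hg).aestronglyMeasurable
      (ae_of_all _ fun w => ?_)
    simp only [norm_mul, Real.norm_eq_abs, abs_of_nonneg hM0]
    rw [mul_comm]
    exact mul_le_mul_of_nonneg_right (hM w) (abs_nonneg _)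
  have hE : Tendsto (fun n => 2 * (√(∫ w, f n w ∂(iidLaw (sqMeasure μ u₀) n)) *
      √(Real.exp (16 * (2 * M + M ^ 2) ^ 2)))) atTop (𝓝 0) := by
    simpa using (h0.sqrt.mul_const (√(Real.exp (16 * (2 * M + M ^ 2) ^ 2)))).const_mul 2
  filter_upwards [eventually_ge_atTop 1, hE.eventually_lt_const (half_pos hε),
    hq.tendsto.eventually_lt_const hδ, (tendsto_div_sqrt_nat (2 * M + M ^ 2)).eventually_lt_const
      (show (0 : ℝ) < 1 / 2 by norm_num)] with n hn hE hρ hs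
  have hκ : ∫ w, (√n * (u n w - u₀ w) - u₀ w * g w) ^ 2 ∂μ ≤ 4 * δ := by
    have hA := (hq.memLp_remainder n).integrable_sq.const_mul 2
    have hB := (hq.memLp_dir.sub hgL).integrable_sq.const_mul 2
    simp only [Pi.sub_apply] at hB
    have h1 : ∫ w, (√n * (u n w - u₀ w) - u₀ w * g w) ^ 2 ∂μ ≤
        2 * ∫ w, (√n * (u n w - u₀ w) - a w) ^ 2 ∂μ + 2 * ∫ w, (a w - u₀ w * g w) ^ 2 ∂μ := by
      rw [← integral_const_mul, ← integral_const_mul, ← integral_add hA hB]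
      refine integral_mono_of_nonneg (ae_of_all _ fun _ => sq_nonneg _) (hA.add hB)
        (ae_of_all _ fun w => ?_)
      simp only
      nlinarith [sq_nonneg ((√n * (u n w - u₀ w) - a w) - (a w - u₀ w * g w))]
    linarith
  have hδ1 : δ ≤ ε / 32 := min_le_left _ _
  have hδ2 : δ ≤ 1 / 4 := min_le_right _ _
  have := integral_iidLaw_le_of_bounded_approx hq.measurable_base (hq.measurable_seq n) hg
    hq.memLp_base (hq.memLp_seq n) hq.integral_base (hq.integral_seq n) hM hn hs.le
    (by linarith) hκ (hf n) (hf01 n)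
  linarith

end Contiguity

/-! ### Conditional asymptotic normality -/

section Conditional

lemma isProbabilityMeasure_iidLaw {S : Type*} [MeasurableSpace S] (Q : Measure S)
    [IsProbabilityMeasure Q] (n : ℕ) : IsProbabilityMeasure (iidLaw Q n) := by
  unfold iidLaw; infer_instance

lemma measurable_sum_div_sqrt {S : Type*} [MeasurableSpace S] {r : S → ℝ} (hr : Measurable r)
    (n : ℕ) : Measurable fun w : Fin n → S => (∑ i, r (w i)) / √n :=
  (Finset.univ.measurable_fun_sum fun i _ => hr.comp (measurable_pi_apply i)).div_const _

/-- The bivariate central limit theorem for a pair of uncorrelated centered variables with the same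
variance. -/
lemma tendsto_real_prodMk_sum_div_sqrt {S : Type*} [MeasurableSpace S] (Q : Measure S)
    [IsProbabilityMeasure Q] {r₁ r₂ : S → ℝ} (h₁ : Measurable r₁) (h₂ : Measurable r₂)
    (hL₁ : MemLp r₁ 2 Q) (hL₂ : MemLp r₂ 2 Q) (hm₁ : ∫ w, r₁ w ∂Q = 0) (hm₂ : ∫ w, r₂ w ∂Q = 0)
    {v : NNReal} (hv₁ : ∫ w, r₁ w ^ 2 ∂Q = v) (hv₂ : ∫ w, r₂ w ^ 2 ∂Q = v)
    (h₁₂ : ∫ w, r₁ w * r₂ w ∂Q = 0) {A : Set (ℝ × ℝ)} (hA : MeasurableSet A)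
    (hA0 : ((gaussianReal 0 v).prod (gaussianReal 0 v)) (frontier A) = 0) :
    Tendsto (fun n : ℕ => (iidLaw Q n).real
        {w | ((∑ i, r₁ (w i)) / √n, (∑ i, r₂ (w i)) / √n) ∈ A}) atTop
      (𝓝 (((gaussianReal 0 v).prod (gaussianReal 0 v)).real A)) := by
  have hQn : ∀ n, IsProbabilityMeasure (iidLaw Q n) := isProbabilityMeasure_iidLaw Q
  have hpair : ∀ n : ℕ, Measurable fun w : Fin n → S =>
      ((∑ i, r₁ (w i)) / √n, (∑ i, r₂ (w i)) / √n) := fun n =>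
    (measurable_sum_div_sqrt h₁ n).prodMk (measurable_sum_div_sqrt h₂ n)
  have hmeas : ∀ n : ℕ, Measurable fun w : Fin n → S =>
      WithLp.toLp 2 ((∑ i, r₁ (w i)) / √n, (∑ i, r₂ (w i)) / √n) := fun n =>
    (MeasurableEquiv.toLp 2 (ℝ × ℝ)).measurable.comp (hpair n)
  have hof : Measurable (WithLp.ofLp : WithLp 2 (ℝ × ℝ) → ℝ × ℝ) :=
    (MeasurableEquiv.toLp 2 (ℝ × ℝ)).symm.measurable
  have hto : Measurable (WithLp.toLp 2 : ℝ × ℝ → WithLp 2 (ℝ × ℝ)) :=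
    (MeasurableEquiv.toLp 2 (ℝ × ℝ)).measurable
  have : ∀ n : ℕ, IsProbabilityMeasure ((iidLaw Q n).map fun w =>
      WithLp.toLp 2 ((∑ i, r₁ (w i)) / √n, (∑ i, r₂ (w i)) / √n)) := fun n =>
    Measure.isProbabilityMeasure_map (hmeas n).aemeasurable
  have : IsProbabilityMeasure
      (((gaussianReal 0 v).prod (gaussianReal 0 v)).map (WithLp.toLp 2)) :=
    Measure.isProbabilityMeasure_map hto.aemeasurable
  have hchar : ∀ t : WithLp 2 (ℝ × ℝ), Tendsto (fun n : ℕ => charFun ((iidLaw Q n).map fun w =>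
        WithLp.toLp 2 ((∑ i, r₁ (w i)) / √n, (∑ i, r₂ (w i)) / √n)) t) atTop
      (𝓝 (charFun (((gaussianReal 0 v).prod (gaussianReal 0 v)).map (WithLp.toLp 2)) t)) := by
    intro t
    obtain ⟨⟨t₁, t₂⟩, rfl⟩ : ∃ p : ℝ × ℝ, t = WithLp.toLp 2 p := ⟨t.ofLp, rfl⟩
    -- the linear combination `t₁ r₁ + t₂ r₂` reduces the claim to one dimension
    set r : S → ℝ := fun w => t₁ * r₁ w + t₂ * r₂ w with hr
    have hrm : Measurable r := by fun_prop
    have hrL : MemLp r 2 Q := (hL₁.const_mul t₁).add (hL₂.const_mul t₂)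
    have hr0 : ∫ w, r w ∂Q = 0 := by
      rw [hr, integral_add ((hL₁.integrable (by norm_num)).const_mul _)
        ((hL₂.integrable (by norm_num)).const_mul _), integral_const_mul, integral_const_mul,
        hm₁, hm₂]
      simp
    have hr2 : ∫ w, r w ^ 2 ∂Q = (t₁ ^ 2 + t₂ ^ 2) * v := by
      have e : ∀ w, r w ^ 2 = t₁ ^ 2 * r₁ w ^ 2 + t₂ ^ 2 * r₂ w ^ 2 +
          2 * t₁ * t₂ * (r₁ w * r₂ w) := fun w => by simp only [hr]; ring
      have hI₁₂ : Integrable (fun w => r₁ w * r₂ w) Q := hL₁.integrable_mul hL₂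
      have hI := (hL₁.integrable_sq.const_mul (t₁ ^ 2)).add (hL₂.integrable_sq.const_mul (t₂ ^ 2))
      simp only [Pi.add_def] at hI
      simp only [e]
      rw [integral_add hI (hI₁₂.const_mul _), integral_add (hL₁.integrable_sq.const_mul _)
        (hL₂.integrable_sq.const_mul _), integral_const_mul, integral_const_mul,
        integral_const_mul, hv₁, hv₂, h₁₂]
      ring
    have h1 := tendsto_nat_mul_integral_exp_sub_one Q hrm hrL hr0 1
    have h2 := Complex.tendsto_one_add_pow_exp_of_tendsto h1
    rw [charFun_prod, charFun_gaussianReal, charFun_gaussianReal, ← Complex.exp_add]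
    refine (h2.congr fun n => ?_).trans_eq ?_
    · have e := charFun_map_sum_div_sqrt Q hrm n 1
      rw [add_sub_cancel, ← e, charFun_apply_real, charFun_apply,
        integral_map (measurable_sum_div_sqrt hrm n).aemeasurable (by fun_prop),
        integral_map (hmeas n).aemeasurable (by fun_prop)]
      refine integral_congr_ae (ae_of_all _ fun w => ?_)
      simp only [WithLp.prod_inner_apply, hr, Finset.sum_add_distrib, ← Finset.mul_sum]
      simp
      ring_nf
    · rw [hr2]
      congr 2
      push_cast
      ring
  have hfr : (((gaussianReal 0 v).prod (gaussianReal 0 v)).map (WithLp.toLp 2))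
      (frontier ((WithLp.homeomorphProd 2 ℝ ℝ) ⁻¹' A)) = 0 := by
    rw [← Homeomorph.preimage_frontier, Measure.map_apply hto
      ((WithLp.homeomorphProd 2 ℝ ℝ).continuous.measurable isClosed_frontier.measurableSet)]
    exact hA0
  have key := tendsto_real_of_tendsto_charFun hchar hfr
  have hAm : MeasurableSet ((WithLp.homeomorphProd 2 ℝ ℝ) ⁻¹' A) := hof hA
  rw [map_measureReal_apply hto hAm] at key
  refine key.congr fun n => ?_
  rw [map_measureReal_apply (hmeas n) hAm]
  rfl

lemma iidLaw_prod {U V : Type*} [MeasurableSpace U] [MeasurableSpace V] (ν : Measure U)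
    (ρ : Measure V) [IsProbabilityMeasure ν] [IsProbabilityMeasure ρ] (n : ℕ) :
    iidLaw (ν.prod ρ) n =
      ((iidLaw ν n).prod (iidLaw ρ n)).map fun p i => (p.1 i, p.2 i) :=
  ((measurePreserving_arrowProdEquivProdArrow U V (Fin n) (fun _ => ν) fun _ => ρ).symm
    (MeasurableEquiv.arrowProdEquivProdArrow U V (Fin n))).map_eq.symm

lemma measurable_zipPair {U V : Type*} [MeasurableSpace U] [MeasurableSpace V] (n : ℕ) :
    Measurable fun (p : (Fin n → U) × (Fin n → V)) (i : Fin n) => (p.1 i, p.2 i) := by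
  fun_prop

lemma iidLaw_prod_real_apply {U V : Type*} [MeasurableSpace U] [MeasurableSpace V] (ν : Measure U)
    (ρ : Measure V) [IsProbabilityMeasure ν] [IsProbabilityMeasure ρ] {n : ℕ}
    {A : Set (Fin n → U × V)} (hA : MeasurableSet A) :
    (iidLaw (ν.prod ρ) n).real A =
      ∫ y, (iidLaw ν n).real {z | (fun i => (z i, y i)) ∈ A} ∂(iidLaw ρ n) := by
  have := isProbabilityMeasure_iidLaw ν n
  have := isProbabilityMeasure_iidLaw ρ n
  have hm := measurable_zipPair (U := U) (V := V) n hA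
  rw [iidLaw_prod, map_measureReal_apply (measurable_zipPair n) hA, measureReal_def,
    Measure.prod_apply_symm hm, integral_eq_lintegral_of_nonneg_ae (ae_of_all _ fun _ => by simp)]
  · simp only [measureReal_def, ENNReal.ofReal_toReal (measure_ne_top _ _)]
    rfl
  · exact (measurable_measure_prodMk_right hm).ennreal_toReal.aestronglyMeasurable

/-- If a centered variable `r` has mean zero given the second coordinate, then the conditional
probability that its normalized sum exceeds `x` converges in `L¹` to the Gaussian tail. The
mean square of the conditional probability is the probability that two conditionally independent
copies of the sum both exceed `x`, and these copies are asymptotically independent because they are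
uncorrelated. -/
lemma tendsto_integral_abs_sub_condTail {U V : Type*} [MeasurableSpace U] [MeasurableSpace V]
    (ν : Measure U) (ρ : Measure V) [IsProbabilityMeasure ν] [IsProbabilityMeasure ρ]
    {r : U × V → ℝ} (hr : Measurable r) (hr2 : MemLp r 2 (ν.prod ρ))
    (hr0 : ∀ᵐ y ∂ρ, ∫ x, r (x, y) ∂ν = 0) {v : NNReal} (hv0 : v ≠ 0)
    (hv : ∫ w, r w ^ 2 ∂(ν.prod ρ) = v) (x : ℝ) :
    Tendsto (fun n : ℕ => ∫ y, |(gaussianReal 0 v).real (Set.Ioi x) -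
        (iidLaw ν n).real {z | x < (∑ i, r (z i, y i)) / √n}| ∂(iidLaw ρ n)) atTop (𝓝 0) := by
  set α : ℝ := (gaussianReal 0 v).real (Set.Ioi x) with hα
  set G : ∀ n : ℕ, (Fin n → V) → ℝ := fun n y =>
    (iidLaw ν n).real {z | x < (∑ i, r (z i, y i)) / √n} with hGdef
  have hνn := isProbabilityMeasure_iidLaw ν
  have hρn := isProbabilityMeasure_iidLaw ρ
  have hGm : ∀ n, Measurable (G n) := fun n => by
    have hm : MeasurableSet {p : (Fin n → U) × (Fin n → V) |
        x < (∑ i, r (p.1 i, p.2 i)) / √n} :=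
      measurableSet_lt measurable_const ((measurable_sum_div_sqrt hr n).comp (measurable_zipPair n))
    exact (measurable_measure_prodMk_right hm).ennreal_toReal
  have hG0 : ∀ n y, 0 ≤ G n y := fun n y => measureReal_nonneg
  have hG1 : ∀ n y, G n y ≤ 1 := fun n y => measureReal_le_one
  have hGL : ∀ n, MemLp (G n) 2 (iidLaw ρ n) := fun n =>
    MemLp.of_bound (hGm n).aestronglyMeasurable 1
      (ae_of_all _ fun y => by rw [Real.norm_of_nonneg (hG0 n y)]; exact hG1 n y)
  -- two conditionally independent copies of `r` given the second coordinate
  set Q : Measure ((U × U) × V) := (ν.prod ν).prod ρ with hQ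
  set r₁ : (U × U) × V → ℝ := fun w => r (w.1.1, w.2) with hr₁
  set r₂ : (U × U) × V → ℝ := fun w => r (w.1.2, w.2) with hr₂
  have hr₁m : Measurable r₁ := by fun_prop
  have hr₂m : Measurable r₂ := by fun_prop
  have hp₁ : MeasurePreserving (fun w : (U × U) × V => (w.1.1, w.2)) Q (ν.prod ρ) :=
    (measurePreserving_fst (μ := ν) (ν := ν)).prod (MeasurePreserving.id ρ)
  have hp₂ : MeasurePreserving (fun w : (U × U) × V => (w.1.2, w.2)) Q (ν.prod ρ) :=
    (measurePreserving_snd (μ := ν) (ν := ν)).prod (MeasurePreserving.id ρ)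
  have hL₁ : MemLp r₁ 2 Q := hr2.comp_measurePreserving hp₁
  have hL₂ : MemLp r₂ 2 Q := hr2.comp_measurePreserving hp₂
  have htrans : ∀ {p : (U × U) × V → U × V}, MeasurePreserving p Q (ν.prod ρ) →
      ∀ {g : U × V → ℝ}, Measurable g → ∫ w, g (p w) ∂Q = ∫ w, g w ∂(ν.prod ρ) := by
    intro p hp g hg
    rw [← hp.map_eq, integral_map hp.measurable.aemeasurable hg.aestronglyMeasurable]
  have hmean : ∫ w, r w ∂(ν.prod ρ) = 0 := by
    rw [integral_prod_symm _ (hr2.integrable (by norm_num)), integral_eq_zero_of_ae hr0]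
  have h₁₂ : ∫ w, r₁ w * r₂ w ∂Q = 0 := by
    have hI : Integrable (fun w => r₁ w * r₂ w) ((ν.prod ν).prod ρ) := hL₁.integrable_mul hL₂
    rw [hQ, integral_prod_symm _ hI]
    refine integral_eq_zero_of_ae ?_
    filter_upwards [hr0] with y hy
    simp only [hr₁, hr₂]
    rw [integral_prod_mul (fun u => r (u, y)) (fun u => r (u, y)), hy]
    simp
  have hna : NullSingletonClass (gaussianReal 0 v) := nullSingletonClass_gaussianReal hv0
  have hvert : ((gaussianReal 0 v).prod (gaussianReal 0 v)) ({x} ×ˢ Set.univ) = 0 := by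
    rw [Measure.prod_prod]; simp
  have hhor : ((gaussianReal 0 v).prod (gaussianReal 0 v)) (Set.univ ×ˢ {x}) = 0 := by
    rw [Measure.prod_prod]; simp
  have hbiv : ∀ A : Set (ℝ × ℝ), MeasurableSet A →
      ((gaussianReal 0 v).prod (gaussianReal 0 v)) (frontier A) = 0 → _ := fun A hA hA0 =>
    tendsto_real_prodMk_sum_div_sqrt Q hr₁m hr₂m hL₁ hL₂ ((htrans hp₁ hr).trans hmean)
      ((htrans hp₂ hr).trans hmean) ((htrans hp₁ (hr.pow_const 2)).trans hv)
      ((htrans hp₂ (hr.pow_const 2)).trans hv) h₁₂ hA hA0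
  have hprodm : ∀ n : ℕ, MeasurableSet {w : Fin n → (U × U) × V |
      x < (∑ i, r₁ (w i)) / √n} := fun n =>
    measurableSet_lt measurable_const (measurable_sum_div_sqrt hr₁m n)
  have hprodm₂ : ∀ n : ℕ, MeasurableSet {w : Fin n → (U × U) × V |
      x < (∑ i, r₂ (w i)) / √n} := fun n =>
    measurableSet_lt measurable_const (measurable_sum_div_sqrt hr₂m n)
  have hsect : ∀ (n : ℕ) (y : Fin n → V), MeasurableSet {z : Fin n → U |
      x < (∑ i, r (z i, y i)) / √n} := fun n y =>
    measurableSet_lt measurable_const ((measurable_sum_div_sqrt hr n).comp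
      ((measurable_zipPair n).comp measurable_prodMk_right))
  have hfirst : Tendsto (fun n => ∫ y, G n y ∂(iidLaw ρ n)) atTop (𝓝 α) := by
    have h := hbiv (Set.Ioi x ×ˢ Set.univ) (measurableSet_Ioi.prod MeasurableSet.univ) (by
      rw [frontier_prod_univ_eq, frontier_Ioi]; exact hvert)
    rw [measureReal_prod_prod, probReal_univ, mul_one] at h
    refine h.congr fun n => ?_
    have e : {w : Fin n → (U × U) × V | ((∑ i, r₁ (w i)) / √n, (∑ i, r₂ (w i)) / √n) ∈
        Set.Ioi x ×ˢ (Set.univ : Set ℝ)} = {w | x < (∑ i, r₁ (w i)) / √n} := by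
      ext w; simp
    rw [e, hQ, iidLaw_prod_real_apply _ _ (hprodm n)]
    refine integral_congr_ae (ae_of_all _ fun y => ?_)
    simp only [hGdef]
    rw [iidLaw_prod, map_measureReal_apply (measurable_zipPair n)]
    · have e2 : (fun (p : (Fin n → U) × (Fin n → U)) i => (p.1 i, p.2 i)) ⁻¹'
          {z | (fun i => (z i, y i)) ∈ {w | x < (∑ i, r₁ (w i)) / √n}} =
          {z | x < (∑ i, r (z i, y i)) / √n} ×ˢ Set.univ := by
        ext p; simp [hr₁]
      rw [e2, measureReal_prod_prod, probReal_univ, mul_one]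
    · exact (measurable_zipPair n).comp measurable_prodMk_right (hprodm n)
  have hsecond : Tendsto (fun n => ∫ y, G n y ^ 2 ∂(iidLaw ρ n)) atTop (𝓝 (α ^ 2)) := by
    have h := hbiv (Set.Ioi x ×ˢ Set.Ioi x) (measurableSet_Ioi.prod measurableSet_Ioi) (by
      rw [frontier_prod_eq, frontier_Ioi]
      refine measure_union_null ?_ ?_
      · exact measure_mono_null (Set.prod_mono (Set.subset_univ _) subset_rfl) hhor
      · exact measure_mono_null (Set.prod_mono subset_rfl (Set.subset_univ _)) hvert)
    rw [measureReal_prod_prod, ← hα, ← sq] at h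
    refine h.congr fun n => ?_
    have e : {w : Fin n → (U × U) × V | ((∑ i, r₁ (w i)) / √n, (∑ i, r₂ (w i)) / √n) ∈
        Set.Ioi x ×ˢ Set.Ioi x} =
        {w | x < (∑ i, r₁ (w i)) / √n} ∩ {w | x < (∑ i, r₂ (w i)) / √n} := by
      ext w; simp
    rw [e, hQ, iidLaw_prod_real_apply _ _ ((hprodm n).inter (hprodm₂ n))]
    refine integral_congr_ae (ae_of_all _ fun y => ?_)
    simp only [hGdef]
    rw [iidLaw_prod, map_measureReal_apply (measurable_zipPair n)]
    · have e2 : (fun (p : (Fin n → U) × (Fin n → U)) i => (p.1 i, p.2 i)) ⁻¹'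
          {z | (fun i => (z i, y i)) ∈ {w | x < (∑ i, r₁ (w i)) / √n} ∩
            {w | x < (∑ i, r₂ (w i)) / √n}} =
          {z | x < (∑ i, r (z i, y i)) / √n} ×ˢ {z | x < (∑ i, r (z i, y i)) / √n} := by
        ext p; simp [hr₁, hr₂]
      rw [e2, measureReal_prod_prod, sq]
    · exact (measurable_zipPair n).comp measurable_prodMk_right ((hprodm n).inter (hprodm₂ n))
  have hvar : Tendsto (fun n => ∫ y, (α - G n y) ^ 2 ∂(iidLaw ρ n)) atTop (𝓝 0) := by
    have h := (hsecond.sub (hfirst.const_mul (2 * α))).const_add (α ^ 2)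
    rw [show α ^ 2 + (α ^ 2 - 2 * α * α) = 0 by ring] at h
    refine h.congr fun n => ?_
    have e : ∀ y, (α - G n y) ^ 2 = α ^ 2 + (G n y ^ 2 - 2 * α * G n y) := fun y => by ring
    have hI : Integrable (fun y => 2 * α * G n y) (iidLaw ρ n) :=
      ((hGL n).integrable (by norm_num)).const_mul _
    have hI' : Integrable (fun y => G n y ^ 2 - 2 * α * G n y) (iidLaw ρ n) :=
      (hGL n).integrable_sq.sub hI
    simp only [e]
    rw [integral_add (integrable_const _) hI', integral_sub (hGL n).integrable_sq hI,
      integral_const_mul]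
    simp
  have hsqrt := hvar.sqrt
  rw [Real.sqrt_zero] at hsqrt
  refine squeeze_zero (fun n => integral_nonneg fun _ => abs_nonneg _) (fun n => ?_) hsqrt
  have hcs := integral_abs_mul_abs_le_sqrt_mul_sqrt ((memLp_const α).sub (hGL n))
    (memLp_const (μ := iidLaw ρ n) (1 : ℝ))
  simpa using hcs

end Conditional

/-! ### Conditional randomization tests -/

/-- A test that rejects for large values of `T` with a cutoff depending on `y` only, and with
conditional size `α` given `y`, is close in `L¹` to the test `R > x` as soon as `T - R` is small up
to a function of `y` and `R > x` has conditional probability close to `α`. On the `y`-measurable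
event where the recentered cutoff is at most `x` the difference of the tests is nonnegative
up to the boundary error, and nonpositive on the complement, so its `L¹` norm
is a signed integral, which only depends on the conditional sizes. -/
lemma integral_abs_sub_indicator_le {A B : Type*} [MeasurableSpace A] [MeasurableSpace B]
    {ν : Measure A} {ρ : Measure B} [IsProbabilityMeasure ν] [IsProbabilityMeasure ρ]
    {φ T R : A × B → ℝ} {c : B → ℝ} (hφ : Measurable φ) (hT : Measurable T) (hR : Measurable R)
    (hc : Measurable c) (hφ01 : ∀ p, φ p ∈ Set.Icc (0 : ℝ) 1)
    (hrej : ∀ p, c p.2 < T p → φ p = 1) (hacc : ∀ p, T p < c p.2 → φ p = 0) {α : ℝ}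
    (hsize : ∀ᵐ y ∂ρ, ∫ z, φ (z, y) ∂ν = α) (x ε : ℝ) :
    ∫ p, |φ p - {p | x < R p}.indicator 1 p| ∂(ν.prod ρ) ≤
      ∫ y, |α - ν.real {z | x < R (z, y)}| ∂ρ +
        2 * ((ν.prod ρ).real {p | R p ∈ Set.Icc (x - ε) (x + ε)} +
          (ν.prod ρ).real {p | ε ≤ |T p - R p|}) := by
  have hG : MeasurableSet {p | x < R p} := measurableSet_lt measurable_const hR
  have hB₁ : MeasurableSet {p | R p ∈ Set.Icc (x - ε) (x + ε)} := hR measurableSet_Icc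
  have hB₂ : MeasurableSet {p | ε ≤ |T p - R p|} :=
    measurableSet_le measurable_const (hT.sub hR).abs
  set D : A × B → ℝ := fun p => φ p - {p | x < R p}.indicator 1 p with hD
  have hDm : Measurable D := hφ.sub (measurable_one.indicator hG)
  have hD1 : ∀ p, |D p| ≤ 1 := fun p => by
    have := hφ01 p
    simp only [hD, Set.indicator_apply, Pi.one_apply]
    split_ifs <;> rw [abs_le] <;> constructor <;> linarith [this.1, this.2]
  -- the sign that the difference of the tests has given `y`, up to the exceptional events
  set s : B → ℝ := fun y => if c y ≤ x then 1 else -1 with hs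
  have hsm : Measurable s :=
    Measurable.ite (measurableSet_le hc measurable_const) measurable_const measurable_const
  have hs1 : ∀ y, |s y| = 1 := fun y => by simp only [hs]; split_ifs <;> simp
  have hDI : Integrable D (ν.prod ρ) :=
    Integrable.of_bound hDm.aestronglyMeasurable 1 (ae_of_all _ hD1)
  have hsDI : Integrable (fun p => s p.2 * D p) (ν.prod ρ) :=
    hDI.bdd_mul (c := 1) (hsm.comp measurable_snd).aestronglyMeasurable
      (ae_of_all _ fun p => (hs1 p.2).le)
  set E₁ : A × B → ℝ := {p | R p ∈ Set.Icc (x - ε) (x + ε)}.indicator 1 with hE₁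
  set E₂ : A × B → ℝ := {p | ε ≤ |T p - R p|}.indicator 1 with hE₂
  have hE₁I : Integrable E₁ (ν.prod ρ) := (integrable_const (1 : ℝ)).indicator hB₁
  have hE₂I : Integrable E₂ (ν.prod ρ) := (integrable_const (1 : ℝ)).indicator hB₂
  have hpt : ∀ p, |D p| ≤ s p.2 * D p + 2 * (E₁ p + E₂ p) := by
    intro p
    have h01 := hφ01 p
    have hE₁0 : 0 ≤ E₁ p := Set.indicator_nonneg (fun _ _ => zero_le_one) _
    have hE₂0 : 0 ≤ E₂ p := Set.indicator_nonneg (fun _ _ => zero_le_one) _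
    have hclose : E₁ p + E₂ p < 1 → (x < R p → x < T p) ∧ (¬ x < R p → T p < x) := by
      intro h
      have n₁ : ¬ (R p ∈ Set.Icc (x - ε) (x + ε)) := fun hp => by
        have : E₁ p = 1 := Set.indicator_of_mem (s := {p | R p ∈ Set.Icc (x - ε) (x + ε)}) hp 1
        linarith
      have n₂ : ¬ (ε ≤ |T p - R p|) := fun hp => by
        have : E₂ p = 1 := Set.indicator_of_mem (s := {p | ε ≤ |T p - R p|}) hp 1
        linarith
      rw [not_le, abs_lt] at n₂
      rw [Set.mem_Icc, not_and_or, not_le, not_le] at n₁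
      constructor <;> intro h' <;> rcases n₁ with n₁ | n₁ <;> linarith
    by_cases hcx : c p.2 ≤ x
    · have hs' : s p.2 = 1 := by simp [hs, hcx]
      have hlow : -(E₁ p + E₂ p) ≤ D p := by
        by_cases hRx : x < R p
        · by_cases h : E₁ p + E₂ p < 1
          · rw [hD]
            simp only [hrej p (hcx.trans_lt ((hclose h).1 hRx)), Set.indicator_apply,
              Set.mem_ofPred_eq, hRx, if_true, Pi.one_apply]
            linarith
          · linarith [(abs_le.1 (hD1 p)).1]
        · simp only [hD, Set.indicator_apply, Set.mem_ofPred_eq, hRx, if_false]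
          linarith [h01.1]
      rw [hs', abs_le]
      constructor <;> linarith
    · have hs' : s p.2 = -1 := by simp [hs, hcx]
      have hup : D p ≤ E₁ p + E₂ p := by
        by_cases hRx : x < R p
        · simp only [hD, Set.indicator_apply, Set.mem_ofPred_eq, hRx, if_true, Pi.one_apply]
          linarith [h01.2]
        · by_cases h : E₁ p + E₂ p < 1
          · rw [hD]
            simp only [hacc p (((hclose h).2 hRx).trans (not_le.1 hcx)), Set.indicator_apply,
              Set.mem_ofPred_eq, hRx, if_false]
            linarith
          · linarith [(abs_le.1 (hD1 p)).2]
      rw [hs', abs_le]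
      constructor <;> linarith
  have hsign : ∫ p, s p.2 * D p ∂(ν.prod ρ) ≤ ∫ y, |α - ν.real {z | x < R (z, y)}| ∂ρ := by
    rw [integral_prod_symm _ hsDI]
    refine (le_abs_self _).trans ((abs_integral_le_integral_abs).trans (le_of_eq ?_))
    refine integral_congr_ae ?_
    filter_upwards [hsize] with y hy
    have hφI : Integrable (fun z => φ (z, y)) ν :=
      Integrable.of_bound (hφ.comp measurable_prodMk_right).aestronglyMeasurable 1
        (ae_of_all _ fun z => by
          rw [Real.norm_of_nonneg (hφ01 _).1]; exact (hφ01 _).2)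
    have hGy : MeasurableSet {z | x < R (z, y)} := measurable_prodMk_right hG
    have e : ∀ z, {p | x < R p}.indicator (1 : A × B → ℝ) (z, y) =
        {z | x < R (z, y)}.indicator 1 z := fun z => by simp [Set.indicator_apply]
    simp only [integral_const_mul, abs_mul, hs1, one_mul, hD, e]
    have hGI : Integrable ({z | x < R (z, y)}.indicator (1 : A → ℝ)) ν :=
      (integrable_const (1 : ℝ)).indicator hGy
    rw [integral_sub hφI hGI, hy, integral_indicator_one hGy]
  have hEI : Integrable (fun p => 2 * (E₁ p + E₂ p)) (ν.prod ρ) := (hE₁I.add hE₂I).const_mul 2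
  refine (integral_mono hDI.abs (hsDI.add hEI) hpt).trans ?_
  rw [integral_add' hsDI hEI, integral_const_mul,
    integral_add hE₁I hE₂I, hE₁, hE₂, integral_indicator_one hB₁, integral_indicator_one hB₂]
  linarith

/-! ### Consequences of quadratic mean differentiability -/

section QMD

variable {S : Type*} [MeasurableSpace S] {P : ℝ → Measure S} {μ : Measure S} {p : ℝ → S → ℝ}
  {Θ : Set ℝ} {θ₀ : ℝ} {η : S → ℝ}

lemma IsDensityOn.eq_sqMeasure (hp : IsDensityOn P μ p Θ) {θ : ℝ} (hθ : θ ∈ Θ) :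
    P θ = sqMeasure μ fun w => √(p θ w) := by
  rw [(hp θ hθ).2.2, sqMeasure]
  simp only [Real.sq_sqrt ((hp θ hθ).2.1 _)]

lemma IsDensityOn.integrable [∀ θ, IsProbabilityMeasure (P θ)] (hp : IsDensityOn P μ p Θ)
    {θ : ℝ} (hθ : θ ∈ Θ) : Integrable (p θ) μ := by
  refine ⟨(hp θ hθ).1.aestronglyMeasurable, ?_⟩
  rw [hasFiniteIntegral_iff_ofReal (ae_of_all _ (hp θ hθ).2.1)]
  have h : P θ Set.univ = 1 := measure_univ
  rw [(hp θ hθ).2.2, withDensity_apply _ MeasurableSet.univ, Measure.restrict_univ] at h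
  rw [h]
  exact ENNReal.one_lt_top

lemma IsDensityOn.integral_eq_one [∀ θ, IsProbabilityMeasure (P θ)] (hp : IsDensityOn P μ p Θ)
    {θ : ℝ} (hθ : θ ∈ Θ) : ∫ w, p θ w ∂μ = 1 := by
  have h : P θ Set.univ = 1 := measure_univ
  rw [(hp θ hθ).2.2, withDensity_apply _ MeasurableSet.univ, Measure.restrict_univ] at h
  rw [integral_eq_lintegral_of_nonneg_ae (ae_of_all _ (hp θ hθ).2.1)
    (hp θ hθ).1.aestronglyMeasurable, h, ENNReal.toReal_one]

lemma IsDensityOn.memLp_sqrt [∀ θ, IsProbabilityMeasure (P θ)] (hp : IsDensityOn P μ p Θ)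
    {θ : ℝ} (hθ : θ ∈ Θ) : MemLp (fun w => √(p θ w)) 2 μ := by
  rw [memLp_two_iff_integrable_sq (hp θ hθ).1.sqrt.aestronglyMeasurable]
  simp only [Real.sq_sqrt ((hp θ hθ).2.1 _)]
  exact hp.integrable hθ

lemma eventually_add_mem (hΘ : IsOpen Θ) (hθ₀ : θ₀ ∈ Θ) : ∀ᶠ t in 𝓝 (0 : ℝ), θ₀ + t ∈ Θ := by
  have h : Tendsto (fun t : ℝ => θ₀ + t) (𝓝 0) (𝓝 θ₀) := by
    have : ContinuousAt (fun t : ℝ => θ₀ + t) 0 := by fun_prop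
    simpa [ContinuousAt] using this
  exact h.eventually (hΘ.mem_nhds hθ₀)

/-- The quadratic mean derivative is square integrable. -/
lemma IsQMDAt.memLp [∀ θ, IsProbabilityMeasure (P θ)] (hη : IsQMDAt μ p θ₀ η)
    (hp : IsDensityOn P μ p Θ) (hΘ : IsOpen Θ) (hθ₀ : θ₀ ∈ Θ) : MemLp η 2 μ := by
  have hηm := hη.1
  obtain ⟨t, hlt, hmem, ht⟩ := ((hη.2.eventually_lt_const zero_lt_one).and
    (((eventually_add_mem hΘ hθ₀).filter_mono nhdsWithin_le_nhds).and
      self_mem_nhdsWithin)).exists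
  have ht0 : t ≠ 0 := ht
  have hfin : ∫⁻ w, ENNReal.ofReal ((√(p (θ₀ + t) w) - √(p θ₀ w) - t * η w) ^ 2) ∂μ < ⊤ := by
    by_contra hcon
    rw [not_lt, top_le_iff] at hcon
    rw [hcon, ENNReal.top_div_of_ne_top ENNReal.ofReal_ne_top] at hlt
    exact not_top_lt hlt
  have hm₁ := (hp _ hmem).1
  have hm₀ := (hp _ hθ₀).1
  have hrem : MemLp (fun w => √(p (θ₀ + t) w) - √(p θ₀ w) - t * η w) 2 μ := by
    rw [memLp_two_iff_integrable_sq (by fun_prop)]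
    refine ⟨by fun_prop, ?_⟩
    rwa [hasFiniteIntegral_iff_ofReal (ae_of_all _ fun _ => sq_nonneg _)]
  have := (((hp.memLp_sqrt hmem).sub (hp.memLp_sqrt hθ₀)).sub hrem).const_mul t⁻¹
  refine this.ae_eq (ae_of_all _ fun w => ?_)
  simp only [Pi.sub_apply]
  field_simp
  ring

/-- The quadratic mean derivative vanishes on any set where, for increments `t` tending to zero
along some filter, the remainder is at least as large as the linear term `t η`. -/
lemma IsQMDAt.ae_eq_zero_of_le (hη : IsQMDAt μ p θ₀ η) {l : Filter ℝ} [l.NeBot]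
    (hl : l ≤ 𝓝[≠] 0) {W : Set S} (hW : MeasurableSet W)
    (hle : ∀ᶠ t in l, ∀ w ∈ W, (t * η w) ^ 2 ≤ (√(p (θ₀ + t) w) - √(p θ₀ w) - t * η w) ^ 2) :
    ∀ᵐ w ∂μ, w ∈ W → η w = 0 := by
  have hηm := hη.1
  have hbound : ∀ᶠ t in l, ∫⁻ w in W, ENNReal.ofReal (η w ^ 2) ∂μ ≤
      (∫⁻ w, ENNReal.ofReal ((√(p (θ₀ + t) w) - √(p θ₀ w) - t * η w) ^ 2) ∂μ) /
        ENNReal.ofReal (t ^ 2) := by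
    filter_upwards [hle, hl self_mem_nhdsWithin] with t ht ht0
    have ht2 : 0 < t ^ 2 := by
      have : t ≠ 0 := ht0
      positivity
    rw [ENNReal.le_div_iff_mul_le (Or.inl (ENNReal.ofReal_pos.2 ht2).ne')
        (Or.inl ENNReal.ofReal_ne_top),
      ← lintegral_mul_const _ (by fun_prop)]
    refine (lintegral_mono_ae ?_).trans (setLIntegral_le_lintegral W _)
    filter_upwards [ae_restrict_mem hW] with w hw
    rw [← ENNReal.ofReal_mul (sq_nonneg _)]
    refine ENNReal.ofReal_le_ofReal (le_trans (le_of_eq ?_) (ht w hw))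
    ring
  have h0 : ∫⁻ w in W, ENNReal.ofReal (η w ^ 2) ∂μ = 0 :=
    le_antisymm (ge_of_tendsto (hη.2.mono_left hl) hbound) zero_le
  rw [lintegral_eq_zero_iff (by fun_prop), Filter.EventuallyEq, ae_restrict_iff' hW] at h0
  filter_upwards [h0] with w hw hwW
  have := hw hwW
  simp only [Pi.zero_apply, ENNReal.ofReal_eq_zero] at this
  exact pow_eq_zero_iff (two_ne_zero) |>.1 (le_antisymm this (sq_nonneg _))

/-- Where the null density vanishes, `√p` can only increase, so the quadratic mean derivative is
nonnegative by increments from the right and nonpositive by increments from the left. -/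
lemma IsQMDAt.ae_eq_zero (hη : IsQMDAt μ p θ₀ η) (hp₀ : Measurable (p θ₀)) :
    ∀ᵐ w ∂μ, √(p θ₀ w) = 0 → η w = 0 := by
  have hηm := hη.1
  have hZ : MeasurableSet {w | √(p θ₀ w) = 0} :=
    measurableSet_eq_fun hp₀.sqrt measurable_const
  have hneg := hη.ae_eq_zero_of_le (l := 𝓝[>] 0) (nhdsWithin_mono 0 fun t ht => ne_of_gt ht)
    (hZ.inter (measurableSet_le hηm measurable_const : MeasurableSet {w | η w ≤ 0})) (by
      filter_upwards [self_mem_nhdsWithin] with t ht w hw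
      have h1 : √(p θ₀ w) = 0 := hw.1
      have h2 : η w ≤ 0 := hw.2
      have h3 : 0 < t := ht
      rw [h1]
      nlinarith [Real.sqrt_nonneg (p (θ₀ + t) w), mul_nonneg (Real.sqrt_nonneg (p (θ₀ + t) w))
        (mul_nonneg h3.le (neg_nonneg.2 h2))])
  have hpos := hη.ae_eq_zero_of_le (l := 𝓝[<] 0) (nhdsWithin_mono 0 fun t ht => ne_of_lt ht)
    (hZ.inter (measurableSet_le measurable_const hηm : MeasurableSet {w | 0 ≤ η w})) (by
      filter_upwards [self_mem_nhdsWithin] with t ht w hw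
      have h1 : √(p θ₀ w) = 0 := hw.1
      have h2 : 0 ≤ η w := hw.2
      have h3 : t < 0 := ht
      rw [h1]
      nlinarith [Real.sqrt_nonneg (p (θ₀ + t) w), mul_nonneg (Real.sqrt_nonneg (p (θ₀ + t) w))
        (mul_nonneg (neg_nonneg.2 h3.le) h2)])
  filter_upwards [hneg, hpos] with w h1 h2 hw
  rcases le_total (η w) 0 with h | h
  · exact h1 ⟨hw, h⟩
  · exact h2 ⟨hw, h⟩

open Classical in
/-- The half-densities of the local alternatives `θ₀ + h / √n`; the finitely many indices for
which the parameter lies outside `Θ` are assigned the null half-density. -/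
noncomputable def localHalfDensity (p : ℝ → S → ℝ) (Θ : Set ℝ) (θ₀ h : ℝ) (n : ℕ) (w : S) : ℝ :=
  if θ₀ + h / √n ∈ Θ then √(p (θ₀ + h / √n) w) else √(p θ₀ w)

lemma eventually_localParam_mem (hΘ : IsOpen Θ) (hθ₀ : θ₀ ∈ Θ) (h : ℝ) :
    ∀ᶠ n : ℕ in atTop, θ₀ + h / √n ∈ Θ :=
  (tendsto_div_sqrt_nat h).eventually (eventually_add_mem hΘ hθ₀)

/-- The local alternatives of a quadratic mean differentiable family. -/
lemma IsQMDAt.isQMDSeq [∀ θ, IsProbabilityMeasure (P θ)] (hη : IsQMDAt μ p θ₀ η)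
    (hp : IsDensityOn P μ p Θ) (hΘ : IsOpen Θ) (hθ₀ : θ₀ ∈ Θ) (h : ℝ) :
    IsQMDSeq μ (fun w => √(p θ₀ w)) (localHalfDensity p Θ θ₀ h) (fun w => h * η w) := by
  have hηm := hη.1
  have hηL := hη.memLp hp hΘ hθ₀
  have hcase : ∀ n, ∃ θ ∈ Θ, localHalfDensity p Θ θ₀ h n = fun w => √(p θ w) := by
    intro n
    by_cases hn : θ₀ + h / √n ∈ Θ
    · exact ⟨_, hn, by ext w; simp [localHalfDensity, hn]⟩
    · exact ⟨_, hθ₀, by ext w; simp [localHalfDensity, hn]⟩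
  have hone : ∀ θ ∈ Θ, ∫ w, √(p θ w) ^ 2 ∂μ = 1 := fun θ hθ => by
    simp only [Real.sq_sqrt ((hp θ hθ).2.1 _)]
    exact hp.integral_eq_one hθ
  refine ⟨(hp θ₀ hθ₀).1.sqrt, fun n => ?_, hηm.const_mul h, hp.memLp_sqrt hθ₀, fun n => ?_,
    hηL.const_mul h, hone θ₀ hθ₀, fun n => ?_, ?_, ?_⟩
  · obtain ⟨θ, hθ, e⟩ := hcase n
    rw [e]
    exact (hp θ hθ).1.sqrt
  · obtain ⟨θ, hθ, e⟩ := hcase n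
    rw [e]
    exact hp.memLp_sqrt hθ
  · obtain ⟨θ, hθ, e⟩ := hcase n
    rw [e]
    exact hone θ hθ
  · filter_upwards [hη.ae_eq_zero (hp θ₀ hθ₀).1] with w hw h0
    rw [hw h0, mul_zero]
  · rcases eq_or_ne h 0 with rfl | hh
    · refine tendsto_const_nhds.congr fun n => ?_
      simp [localHalfDensity]
    · have ht : Tendsto (fun n : ℕ => h / √n) atTop (𝓝[≠] 0) := by
        refine tendsto_nhdsWithin_of_tendsto_nhds_of_eventually_within _ (tendsto_div_sqrt_nat h) ?_
        filter_upwards [eventually_gt_atTop 0] with n hn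
        have : (0 : ℝ) < n := by exact_mod_cast hn
        exact div_ne_zero hh (Real.sqrt_pos.2 this).ne'
      have h1 := (ENNReal.tendsto_toReal ENNReal.zero_ne_top).comp (hη.2.comp ht)
      have h2 := h1.const_mul (h ^ 2)
      rw [ENNReal.toReal_zero, mul_zero] at h2
      refine h2.congr' ?_
      filter_upwards [eventually_localParam_mem hΘ hθ₀ h, eventually_gt_atTop 0] with n hn hn0
      have hn1 : (0 : ℝ) < n := by exact_mod_cast hn0
      have hs := Real.sqrt_pos.2 hn1
      have hsq : √(n : ℝ) ^ 2 = n := Real.sq_sqrt hn1.le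
      have hm := (hp _ hn).1
      have hm₀ := (hp _ hθ₀).1
      have e : ∀ w, (√n * (localHalfDensity p Θ θ₀ h n w - √(p θ₀ w)) - h * η w) ^ 2 =
          n * (√(p (θ₀ + h / √n) w) - √(p θ₀ w) - h / √n * η w) ^ 2 := fun w => by
        simp only [localHalfDensity, hn, if_true]
        rw [show √n * (√(p (θ₀ + h / √n) w) - √(p θ₀ w)) - h * η w =
            √n * (√(p (θ₀ + h / √n) w) - √(p θ₀ w) - h / √n * η w) by
          rw [mul_sub (√n) _ (h / √n * η w), ← mul_assoc, mul_div_cancel₀ _ hs.ne'], mul_pow, hsq]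
      simp only [e, Function.comp_apply]
      rw [integral_const_mul, integral_eq_lintegral_of_nonneg_ae
        (ae_of_all _ fun _ => sq_nonneg _)
        (Measurable.aestronglyMeasurable (by fun_prop)), ENNReal.toReal_div,
        ENNReal.toReal_ofReal (sq_nonneg _), div_pow, hsq]
      field_simp

/-- Where the density is differentiable at `θ₀`, the score is the logarithmic derivative: the
pointwise and the quadratic mean limits of the difference quotients of `√p` agree by Fatou's
lemma. -/
lemma IsQMDAt.score_ae_eq [∀ θ, IsProbabilityMeasure (P θ)] (hη : IsQMDAt μ p θ₀ η)
    (hp : IsDensityOn P μ p Θ) (hΘ : IsOpen Θ) (hθ₀ : θ₀ ∈ Θ)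
    (hdiff : ∀ᵐ w ∂(P θ₀), DifferentiableAt ℝ (fun θ => p θ w) θ₀) :
    score p θ₀ η =ᵐ[P θ₀] fun w => deriv (fun θ => p θ w) θ₀ / p θ₀ w := by
  classical
  have hηm := hη.1
  have hm₀ := (hp _ hθ₀).1
  set F : ℝ → S → ENNReal := fun t w => if θ₀ + t ∈ Θ then
    ENNReal.ofReal ((√(p (θ₀ + t) w) - √(p θ₀ w) - t * η w) ^ 2) / ENNReal.ofReal (t ^ 2) else 0
    with hF
  have hFm : ∀ t, Measurable (F t) := fun t => by
    by_cases ht : θ₀ + t ∈ Θ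
    · have hm := (hp _ ht).1
      simp only [hF, ht, if_true]
      fun_prop
    · simp only [hF, ht, if_false]
      fun_prop
  have hmem : ∀ᶠ t in 𝓝[≠] (0 : ℝ), θ₀ + t ∈ Θ :=
    (eventually_add_mem hΘ hθ₀).filter_mono nhdsWithin_le_nhds
  have hFint : Tendsto (fun t => ∫⁻ w, F t w ∂μ) (𝓝[≠] 0) (𝓝 0) := by
    refine hη.2.congr' ?_
    filter_upwards [hmem] with t ht
    have hm := (hp _ ht).1
    simp only [hF, ht, if_true, div_eq_mul_inv]
    rw [lintegral_mul_const _ (by fun_prop)]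
  have hτ : Tendsto (fun k : ℕ => 1 / ((k : ℝ) + 1)) atTop (𝓝[≠] 0) :=
    tendsto_nhdsWithin_of_tendsto_nhds_of_eventually_within _
      tendsto_one_div_add_atTop_nhds_zero_nat
      (Eventually.of_forall fun k => (Nat.one_div_pos_of_nat (α := ℝ)).ne')
  set τ : ℕ → ℝ := fun k => 1 / ((k : ℝ) + 1)
  have hlim : ∫⁻ w, liminf (fun k => F (τ k) w) atTop ∂μ = 0 :=
    le_antisymm ((lintegral_liminf_le fun k => hFm (τ k)).trans_eq
      (hFint.comp hτ).liminf_eq) zero_le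
  have hlim_ae : ∀ᵐ w ∂μ, liminf (fun k => F (τ k) w) atTop = 0 :=
    (lintegral_eq_zero_iff (Measurable.liminf fun k => hFm (τ k))).1 hlim
  rw [(hp θ₀ hθ₀).2.2] at hdiff ⊢
  rw [Filter.EventuallyEq, ae_withDensity_iff (by fun_prop)]
  rw [ae_withDensity_iff (by fun_prop)] at hdiff
  filter_upwards [hdiff, hlim_ae] with w hd hl hw
  have hp0 : 0 < p θ₀ w := by simpa using hw
  have hs0 := Real.sqrt_pos.2 hp0
  have hsq : √(p θ₀ w) ^ 2 = p θ₀ w := Real.sq_sqrt hp0.le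
  set D := deriv (fun θ => p θ w) θ₀ with hD
  have hderiv : HasDerivAt (fun t : ℝ => √(p (θ₀ + t) w)) (D / (2 * √(p θ₀ w))) 0 := by
    have h1 := (hd hw).hasDerivAt
    have h2 : HasDerivAt (fun t : ℝ => p (θ₀ + t) w) D 0 := by
      have h3 : HasDerivAt (fun θ => p θ w) D (θ₀ + 0) := by rw [add_zero]; exact h1
      exact h3.comp_const_add θ₀ 0
    have := h2.sqrt (by simpa using hp0.ne')
    simpa using this
  have hpt : Tendsto (fun t => F t w) (𝓝[≠] 0)
      (𝓝 (ENNReal.ofReal ((D / (2 * √(p θ₀ w)) - η w) ^ 2))) := by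
    have h1 := hderiv.tendsto_slope_zero
    have h2 := ENNReal.tendsto_ofReal ((h1.sub_const (η w)).pow 2)
    refine h2.congr' ?_
    filter_upwards [hmem, self_mem_nhdsWithin] with t ht ht0
    have ht1 : t ≠ 0 := ht0
    have ht2 : 0 < t ^ 2 := by positivity
    simp only [hF, ht, if_true]
    rw [← ENNReal.ofReal_div_of_pos ht2]
    congr 1
    simp only [zero_add, add_zero, smul_eq_mul]
    field_simp
  have hl' : liminf (fun k => F (τ k) w) atTop = _ := (hpt.comp hτ).liminf_eq
  rw [hl', ENNReal.ofReal_eq_zero] at hl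
  have hη' : D / (2 * √(p θ₀ w)) = η w :=
    sub_eq_zero.1 (pow_eq_zero_iff two_ne_zero |>.1 (le_antisymm hl (sq_nonneg _)))
  rw [score, ← hη', show D / p θ₀ w = D / √(p θ₀ w) ^ 2 by rw [hsq]]
  field_simp

end QMD

/-! ### The null distribution of normalized sums -/

/-- The central limit theorem for continuity sets of the normal limit. -/
lemma tendsto_real_sum_div_sqrt_null {S : Type*} [MeasurableSpace S] (P : Measure S)
    [IsProbabilityMeasure P] {r : S → ℝ} (hr : Measurable r) (hr2 : MemLp r 2 P)
    (h0 : ∫ w, r w ∂P = 0) {v : NNReal} (hv : ∫ w, r w ^ 2 ∂P = v) {A : Set ℝ}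
    (hA : MeasurableSet A) (hA0 : gaussianReal 0 v (frontier A) = 0) :
    Tendsto (fun n : ℕ => (iidLaw P n).real {w | (∑ i, r (w i)) / √n ∈ A}) atTop
      (𝓝 ((gaussianReal 0 v).real A)) := by
  have hP : sqMeasure P (fun _ => 1) = P := by simp [sqMeasure]
  have hq : IsQMDSeq P (fun _ => 1) (fun _ _ => 1) (fun _ => 0) :=
    { measurable_base := measurable_const
      measurable_seq := fun _ => measurable_const
      measurable_dir := measurable_const
      memLp_base := memLp_const 1
      memLp_seq := fun _ => memLp_const 1
      memLp_dir := memLp_const 0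
      integral_base := by simp
      integral_seq := by simp
      dir_eq_zero := by simp
      tendsto := by simp }
  have := hq.tendsto_real_sum_div_sqrt hr (by rwa [hP]) (by rwa [hP]) (v := v) (by rwa [hP])
    (m := 0) (by simp) hA hA0
  simpa only [hP] using this

/-! ### Resampling through uniform variables -/

section Resampling

open scoped unitInterval

variable {𝓧 𝓨 𝓩 : Type*} [MeasurableSpace 𝓧] [MeasurableSpace 𝓨] [MeasurableSpace 𝓩]

/-- The observation `(f (Z, U), Y, Z)` obtained from a uniform variable `U` and `(Y, Z)`. -/
def quantileObs (f : 𝓩 → I → 𝓧) (q : I × 𝓨 × 𝓩) : 𝓧 × 𝓨 × 𝓩 := (f q.2.2 q.1, q.2)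

lemma measurable_quantileObs {f : 𝓩 → I → 𝓧} (hf : Measurable (Function.uncurry f)) :
    Measurable (quantileObs f : I × 𝓨 × 𝓩 → 𝓧 × 𝓨 × 𝓩) := by
  have : Measurable fun q : I × 𝓨 × 𝓩 => f q.2.2 q.1 :=
    hf.comp ((measurable_snd.comp measurable_snd).prodMk measurable_fst)
  exact this.prodMk measurable_snd

/-- The residual has mean zero given `(Y, Z)`. -/
lemma ae_integral_residual_quantileObs_eq_zero (P : Measure (𝓧 × 𝓨 × 𝓩)) [IsProbabilityMeasure P]
    {f : 𝓩 → I → 𝓧} (hf : Measurable (Function.uncurry f))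
    (hfP : ((volume : Measure I).prod (P.map Prod.snd)).map (quantileObs f) = P)
    {ψ : 𝓧 × 𝓨 × 𝓩 → ℝ} (hψ : Measurable ψ) (hψ_int : Integrable ψ P) :
    ∀ᵐ y ∂(P.map Prod.snd), ∫ u, residual P ψ (quantileObs f (u, y)) = 0 := by
  have hq := measurable_quantileObs (𝓨 := 𝓨) hf
  have : IsProbabilityMeasure (P.map (Prod.snd : 𝓧 × 𝓨 × 𝓩 → 𝓨 × 𝓩)) :=
    Measure.isProbabilityMeasure_map measurable_snd.aemeasurable
  have hle : MeasurableSpace.comap (Prod.snd : 𝓧 × 𝓨 × 𝓩 → 𝓨 × 𝓩) inferInstance ≤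
      (inferInstance : MeasurableSpace (𝓧 × 𝓨 × 𝓩)) := measurable_snd.comap_le
  have hrm : Measurable (residual P ψ) :=
    hψ.sub (stronglyMeasurable_condExp.mono hle).measurable
  have hrI : Integrable (residual P ψ) P := hψ_int.sub integrable_condExp
  have hrI' : Integrable (fun q => residual P ψ (quantileObs f q))
      ((volume : Measure I).prod (P.map Prod.snd)) := by
    have h := hrI
    rw [← hfP] at h
    have h2 := (integrable_map_measure (by rw [hfP]; exact hrI.aestronglyMeasurable)
      hq.aemeasurable).1 h
    rw [hfP] at h2
    exact h2
  refine Integrable.ae_eq_zero_of_forall_setIntegral_eq_zero hrI'.integral_prod_right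
    fun B hB _ => ?_
  have h1 : ∫ w in Prod.snd ⁻¹' B, residual P ψ w ∂P = 0 := by
    unfold residual condMeanYZ
    rw [integral_sub hψ_int.integrableOn integrable_condExp.integrableOn,
      setIntegral_condExp hle hψ_int ⟨B, hB, rfl⟩, sub_self]
  rw [← h1]
  have hmap := integral_map (μ := (volume : Measure I).prod (P.map Prod.snd)) hq.aemeasurable
    (f := (Prod.snd ⁻¹' B).indicator (residual P ψ))
    (hrm.indicator (measurable_snd hB)).aestronglyMeasurable
  have hind : ∀ q : I × 𝓨 × 𝓩, (Prod.snd ⁻¹' B).indicator (residual P ψ) (quantileObs f q) =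
      (Prod.snd ⁻¹' B).indicator (fun q => residual P ψ (quantileObs f q)) q := fun q => rfl
  simp only [hind] at hmap
  rw [hfP, integral_indicator (measurable_snd hB),
    integral_prod_symm _ (hrI'.indicator (measurable_snd hB))] at hmap
  rw [hmap, ← integral_indicator hB]
  refine integral_congr_ae (ae_of_all _ fun y => ?_)
  by_cases hy : y ∈ B <;> simp [hy]

lemma iidLaw_eq_map_quantileObs (P : Measure (𝓧 × 𝓨 × 𝓩)) [IsProbabilityMeasure P]
    {f : 𝓩 → I → 𝓧} (hf : Measurable (Function.uncurry f))
    (hfP : ((volume : Measure I).prod (P.map Prod.snd)).map (quantileObs f) = P) (n : ℕ) :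
    iidLaw P n = ((iidLaw (volume : Measure I) n).prod (iidLaw (P.map Prod.snd) n)).map
      fun q i => quantileObs f (q.1 i, q.2 i) := by
  have hq := measurable_quantileObs (𝓨 := 𝓨) hf
  have : IsProbabilityMeasure (P.map (Prod.snd : 𝓧 × 𝓨 × 𝓩 → 𝓨 × 𝓩)) :=
    Measure.isProbabilityMeasure_map measurable_snd.aemeasurable
  have h1 : iidLaw P n = (iidLaw ((volume : Measure I).prod (P.map Prod.snd)) n).map
      fun w i => quantileObs f (w i) := by
    have : IsProbabilityMeasure (((volume : Measure I).prod (P.map Prod.snd)).map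
        (quantileObs f)) := Measure.isProbabilityMeasure_map hq.aemeasurable
    rw [iidLaw, iidLaw, Measure.pi_map_pi fun _ => hq.aemeasurable]
    simp only [hfP]
  have hm : Measurable fun (w : Fin n → I × 𝓨 × 𝓩) i => quantileObs f (w i) :=
    measurable_pi_lambda _ fun i => hq.comp (measurable_pi_apply i)
  rw [h1, iidLaw_prod, Measure.map_map hm (measurable_zipPair n)]
  rfl

lemma iidLaw_map_snd (P : Measure (𝓧 × 𝓨 × 𝓩)) [IsProbabilityMeasure P] (n : ℕ) :
    iidLaw (P.map Prod.snd) n = (iidLaw P n).map fun w i => (w i).2 := by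
  have : IsProbabilityMeasure (P.map (Prod.snd : 𝓧 × 𝓨 × 𝓩 → 𝓨 × 𝓩)) :=
    Measure.isProbabilityMeasure_map measurable_snd.aemeasurable
  rw [iidLaw, iidLaw, Measure.pi_map_pi fun _ => measurable_snd.aemeasurable]

variable [StandardBorelSpace 𝓧] [Nonempty 𝓧]

lemma resampleLaw_eq_map (P : Measure (𝓧 × 𝓨 × 𝓩)) [IsProbabilityMeasure P]
    {f : 𝓩 → I → 𝓧} (hf : Measurable (Function.uncurry f))
    (hfP : ∀ z, (volume : Measure I).map (f z) =
      condDistrib (fun w : 𝓧 × 𝓨 × 𝓩 => w.1) (fun w => w.2.2) P z) {n : ℕ}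
    (y : Fin n → 𝓨 × 𝓩) :
    resampleLaw P y = (iidLaw (volume : Measure I) n).map fun z i => f (y i).2 (z i) := by
  have hm : ∀ z, Measurable (f z) := fun z => hf.comp measurable_prodMk_left
  have : ∀ i, IsProbabilityMeasure ((volume : Measure I).map (f (y i).2)) := fun i =>
    Measure.isProbabilityMeasure_map (hm _).aemeasurable
  rw [iidLaw, Measure.pi_map_pi fun i => (hm _).aemeasurable, resampleLaw]
  simp only [hfP]

/-- The conditional size of the test, with the resampled variables generated from uniform ones. -/
lemma IsCRT.ae_integral_quantileObs {P : Measure (𝓧 × 𝓨 × 𝓩)} [IsProbabilityMeasure P] {α : ℝ}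
    {n : ℕ} {T : (Fin n → 𝓧 × 𝓨 × 𝓩) → ℝ} {c : (Fin n → 𝓨 × 𝓩) → ℝ}
    {φ : (Fin n → 𝓧 × 𝓨 × 𝓩) → ℝ} (hφ : IsCRT P α T c φ)
    {f : 𝓩 → I → 𝓧} (hf : Measurable (Function.uncurry f))
    (hfP : ∀ z, (volume : Measure I).map (f z) =
      condDistrib (fun w : 𝓧 × 𝓨 × 𝓩 => w.1) (fun w => w.2.2) P z) :
    ∀ᵐ y ∂(iidLaw (P.map Prod.snd) n),
      ∫ z, φ (fun i => quantileObs f (z i, y i)) ∂(iidLaw (volume : Measure I) n) = α := by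
  have hq := measurable_quantileObs (𝓨 := 𝓨) hf
  have hνn := isProbabilityMeasure_iidLaw (volume : Measure I) n
  have hΨ : Measurable fun (q : (Fin n → I) × (Fin n → 𝓨 × 𝓩)) i =>
      quantileObs f (q.1 i, q.2 i) := measurable_pi_lambda _ fun i => hq.comp (by fun_prop)
  have hint : Measurable fun y : Fin n → 𝓨 × 𝓩 =>
      ∫ z, φ (fun i => quantileObs f (z i, y i)) ∂(iidLaw (volume : Measure I) n) :=
    (StronglyMeasurable.integral_prod_left'
      (hφ.measurable_test.comp hΨ).stronglyMeasurable).measurable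
  have hm : Measurable fun (w : Fin n → 𝓧 × 𝓨 × 𝓩) i => (w i).2 := by fun_prop
  rw [iidLaw_map_snd, ae_map_iff hm.aemeasurable (measurableSet_eq_fun hint measurable_const)]
  filter_upwards [hφ.size] with w hw
  have hfm : Measurable fun (z : Fin n → I) i => f (w i).2.2 (z i) :=
    measurable_pi_lambda _ fun i =>
      (hf.comp measurable_prodMk_left : Measurable (f (w i).2.2)).comp (measurable_pi_apply i)
  rw [← hw, resampleLaw_eq_map P hf hfP, integral_map hfm.aemeasurable]
  · rfl
  · have : Measurable fun (x : Fin n → 𝓧) i => (x i, (w i).2) := by fun_prop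
    exact (hφ.measurable_test.comp this).aestronglyMeasurable

variable [StandardBorelSpace 𝓨] [StandardBorelSpace 𝓩]

/-- Under conditional independence of `X` and `Y` given `Z`, an observation from `P` is obtained
from `(Y, Z)` and an independent uniform variable, through the conditional law of `X` given `Z`. -/
lemma map_quantileObs (P : Measure (𝓧 × 𝓨 × 𝓩)) [IsProbabilityMeasure P]
    (hnull : CondIndepFun
      (MeasurableSpace.comap (fun w : 𝓧 × 𝓨 × 𝓩 => w.2.2) inferInstance)
      (measurable_snd.comp measurable_snd).comap_le
      (fun w : 𝓧 × 𝓨 × 𝓩 => w.1) (fun w : 𝓧 × 𝓨 × 𝓩 => w.2.1) P)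
    {f : 𝓩 → I → 𝓧} (hf : Measurable (Function.uncurry f))
    (hfP : ∀ z, (volume : Measure I).map (f z) =
      condDistrib (fun w : 𝓧 × 𝓨 × 𝓩 => w.1) (fun w => w.2.2) P z) :
    ((volume : Measure I).prod (P.map Prod.snd)).map (quantileObs f) = P := by
  have hne : Nonempty (𝓧 × 𝓨 × 𝓩) := P.nonempty_of_neZero
  have : Nonempty 𝓨 := ⟨hne.some.2.1⟩
  have hX : Measurable (fun w : 𝓧 × 𝓨 × 𝓩 => w.1) := measurable_fst
  have hY : Measurable (fun w : 𝓧 × 𝓨 × 𝓩 => w.2.1) := measurable_fst.comp measurable_snd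
  have hZ : Measurable (fun w : 𝓧 × 𝓨 × 𝓩 => w.2.2) := measurable_snd.comp measurable_snd
  have h1 := (condIndepFun_iff_condDistrib_prod_ae_eq_prodMkRight hX hY hZ).1 hnull.symm
  rw [condDistrib_ae_eq_iff_measure_eq_compProd _ hX.aemeasurable] at h1
  have : IsProbabilityMeasure (P.map (Prod.snd : 𝓧 × 𝓨 × 𝓩 → 𝓨 × 𝓩)) :=
    Measure.isProbabilityMeasure_map measurable_snd.aemeasurable
  ext A hA
  have hq := measurable_quantileObs (𝓨 := 𝓨) hf
  rw [Measure.map_apply hq hA, Measure.prod_apply_symm (hq hA),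
    lintegral_map (measurable_measure_prodMk_right (hq hA)) measurable_snd]
  set A' : Set ((𝓩 × 𝓨) × 𝓧) := (fun q : (𝓩 × 𝓨) × 𝓧 => (q.2, q.1.2, q.1.1)) ⁻¹' A with hA'
  have hA'm : MeasurableSet A' := by
    have : Measurable fun q : (𝓩 × 𝓨) × 𝓧 => (q.2, q.1.2, q.1.1) := by fun_prop
    exact this hA
  have h2 : P A = (P.map fun w : 𝓧 × 𝓨 × 𝓩 => ((w.2.2, w.2.1), w.1)) A' := by
    rw [Measure.map_apply (by fun_prop) hA'm]
    rfl
  rw [h2, h1, Measure.compProd_apply hA'm,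
    lintegral_map (Kernel.measurable_kernel_prodMk_left hA'm) (hZ.prodMk hY)]
  refine lintegral_congr fun w => ?_
  rw [Kernel.prodMkRight_apply, ← hfP,
    Measure.map_apply (f := f w.2.2) (hf.comp measurable_prodMk_left)
      (measurable_prodMk_left hA'm)]
  rfl

/-- Under the null hypothesis, the conditional randomization test agrees up to an asymptotically
negligible probability with the test that compares the normalized sum of residuals to a fixed
Gaussian cutoff. -/
theorem tendsto_integral_abs_crt_sub_indicator (P : Measure (𝓧 × 𝓨 × 𝓩)) [IsProbabilityMeasure P]
    (hnull : CondIndepFun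
      (MeasurableSpace.comap (fun w : 𝓧 × 𝓨 × 𝓩 => w.2.2) inferInstance)
      (measurable_snd.comp measurable_snd).comap_le
      (fun w : 𝓧 × 𝓨 × 𝓩 => w.1) (fun w : 𝓧 × 𝓨 × 𝓩 => w.2.1) P)
    {ψ : 𝓧 × 𝓨 × 𝓩 → ℝ} (hψ : Measurable ψ) (hψ_int : Integrable ψ P)
    (hψ_sq : MemLp (residual P ψ) 2 P)
    {T : ∀ n : ℕ, (Fin n → 𝓧 × 𝓨 × 𝓩) → ℝ} (hT : ∀ n, Measurable (T n))
    (hT_lin : IsAsympLinear P T ψ) {α : ℝ}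
    {c : ∀ n : ℕ, (Fin n → 𝓨 × 𝓩) → ℝ} {φ : ∀ n : ℕ, (Fin n → 𝓧 × 𝓨 × 𝓩) → ℝ}
    (hφ : ∀ n, IsCRT P α (T n) (c n) (φ n)) {v : NNReal} (hv0 : v ≠ 0)
    (hv : ∫ w, residual P ψ w ^ 2 ∂P = v) {x : ℝ}
    (hx : (gaussianReal 0 v).real (Set.Ioi x) = α) :
    Tendsto (fun n : ℕ => ∫ w, |φ n w -
        {w : Fin n → 𝓧 × 𝓨 × 𝓩 | x < (∑ i, residual P ψ (w i)) / √n}.indicator 1 w|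
        ∂(iidLaw P n)) atTop (𝓝 0) := by
  obtain ⟨f, hf, hfP⟩ := Kernel.exists_measurable_map_eq_unitInterval
    (condDistrib (fun w : 𝓧 × 𝓨 × 𝓩 => w.1) (fun w => w.2.2) P)
  have hmap := map_quantileObs P hnull hf hfP
  have hq := measurable_quantileObs (𝓨 := 𝓨) hf
  have hρ : IsProbabilityMeasure (P.map (Prod.snd : 𝓧 × 𝓨 × 𝓩 → 𝓨 × 𝓩)) :=
    Measure.isProbabilityMeasure_map measurable_snd.aemeasurable
  have hνn := isProbabilityMeasure_iidLaw (volume : Measure I)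
  have hρn := isProbabilityMeasure_iidLaw (P.map (Prod.snd : 𝓧 × 𝓨 × 𝓩 → 𝓨 × 𝓩))
  have hPn := isProbabilityMeasure_iidLaw P
  have hle : MeasurableSpace.comap (Prod.snd : 𝓧 × 𝓨 × 𝓩 → 𝓨 × 𝓩) inferInstance ≤
      (inferInstance : MeasurableSpace (𝓧 × 𝓨 × 𝓩)) := measurable_snd.comap_le
  have hrm : Measurable (residual P ψ) :=
    hψ.sub (stronglyMeasurable_condExp.mono hle).measurable
  have hr0 : ∫ w, residual P ψ w ∂P = 0 := by
    unfold residual condMeanYZ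
    rw [integral_sub hψ_int integrable_condExp, integral_condExp hle, sub_self]
  -- the conditional mean is a function of `(Y, Z)`
  obtain ⟨e, hem, he⟩ : ∃ e : 𝓨 × 𝓩 → ℝ, Measurable e ∧ ∀ w, condMeanYZ P ψ w = e w.2 := by
    obtain ⟨e, hem, he⟩ := (stronglyMeasurable_condExp (μ := P) (f := ψ)
      (m := MeasurableSpace.comap (Prod.snd : 𝓧 × 𝓨 × 𝓩 → 𝓨 × 𝓩)
        inferInstance)).measurable.exists_eq_measurable_comp
    exact ⟨e, hem, fun w => congrFun he w⟩
  set r : I × 𝓨 × 𝓩 → ℝ := fun q => residual P ψ (quantileObs f q) with hr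
  have hrm' : Measurable r := hrm.comp hq
  have hmp : MeasurePreserving (quantileObs f) ((volume : Measure I).prod (P.map Prod.snd)) P :=
    ⟨hq, hmap⟩
  have hr2 : MemLp r 2 ((volume : Measure I).prod (P.map Prod.snd)) :=
    hψ_sq.comp_measurePreserving hmp
  have hrv : ∫ q, r q ^ 2 ∂((volume : Measure I).prod (P.map Prod.snd)) = v := by
    rw [← hv]
    have h := integral_map (μ := (volume : Measure I).prod (P.map Prod.snd)) hq.aemeasurable
      (f := fun w => residual P ψ w ^ 2) (hrm.pow_const 2).aestronglyMeasurable
    rw [hmap] at h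
    exact h.symm
  have htail := tendsto_integral_abs_sub_condTail (volume : Measure I) (P.map Prod.snd) hrm' hr2
    (ae_integral_residual_quantileObs_eq_zero P hf hmap hψ hψ_int) hv0 hrv x
  rw [hx] at htail
  have hna : NullSingletonClass (gaussianReal 0 v) := nullSingletonClass_gaussianReal hv0
  have hRm : ∀ n : ℕ, Measurable fun w : Fin n → 𝓧 × 𝓨 × 𝓩 =>
      (∑ i, residual P ψ (w i)) / √n := fun n => measurable_sum_div_sqrt hrm n
  have hΨ : ∀ n : ℕ, Measurable fun (q : (Fin n → I) × (Fin n → 𝓨 × 𝓩)) i =>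
      quantileObs f (q.1 i, q.2 i) := fun n => measurable_pi_lambda _ fun i => hq.comp (by fun_prop)
  -- the nonasymptotic comparison, transported to the law of the observations
  have hcomp : ∀ (ε : ℝ) (n : ℕ), ∫ w, |φ n w -
        {w : Fin n → 𝓧 × 𝓨 × 𝓩 | x < (∑ i, residual P ψ (w i)) / √n}.indicator 1 w|
        ∂(iidLaw P n) ≤
      ∫ y, |α - (iidLaw (volume : Measure I) n).real {z | x < (∑ i, r (z i, y i)) / √n}|
          ∂(iidLaw (P.map Prod.snd) n) +
        2 * ((iidLaw P n).real {w | (∑ i, residual P ψ (w i)) / √n ∈ Set.Icc (x - ε) (x + ε)} +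
          (iidLaw P n).real {w | ε ≤ |T n w - (∑ i, ψ (w i)) / √n|}) := by
    intro ε n
    -- `T` and the cutoff are both recentered by the sum of the conditional means, a function of
    -- `(Y, Z)`, so that the recentered statistic is close to the sum of residuals
    have hmain := integral_abs_sub_indicator_le (ν := iidLaw (volume : Measure I) n)
      (ρ := iidLaw (P.map Prod.snd) n)
      (φ := fun q => φ n fun i => quantileObs f (q.1 i, q.2 i))
      (T := fun q => T n (fun i => quantileObs f (q.1 i, q.2 i)) - (∑ i, e (q.2 i)) / √n)
      (R := fun q => (∑ i, r (q.1 i, q.2 i)) / √n)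
      (c := fun y => c n y - (∑ i, e (y i)) / √n)
      ((hφ n).measurable_test.comp (hΨ n))
      (((hT n).comp (hΨ n)).sub ((measurable_sum_div_sqrt hem n).comp measurable_snd))
      ((hRm n).comp (hΨ n)) ((hφ n).measurable_cutoff.sub (measurable_sum_div_sqrt hem n))
      (fun q => (hφ n).mem_unit _)
      (fun q hlt => (hφ n).reject _ (by simpa [quantileObs] using hlt))
      (fun q hlt => (hφ n).accept _ (by simpa [quantileObs] using hlt))
      ((hφ n).ae_integral_quantileObs hf hfP) x ε
    have hset₁ : MeasurableSet {w : Fin n → 𝓧 × 𝓨 × 𝓩 |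
        (∑ i, residual P ψ (w i)) / √n ∈ Set.Icc (x - ε) (x + ε)} := hRm n measurableSet_Icc
    have hset₂ : MeasurableSet {w : Fin n → 𝓧 × 𝓨 × 𝓩 |
        ε ≤ |T n w - (∑ i, ψ (w i)) / √n|} :=
      measurableSet_le measurable_const ((hT n).sub (measurable_sum_div_sqrt hψ n)).abs
    have hset : MeasurableSet {w : Fin n → 𝓧 × 𝓨 × 𝓩 |
        x < (∑ i, residual P ψ (w i)) / √n} := measurableSet_lt measurable_const (hRm n)
    have hlaw := iidLaw_eq_map_quantileObs P hf hmap n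
    have e₁ : ∀ A : Set (Fin n → 𝓧 × 𝓨 × 𝓩), MeasurableSet A → (iidLaw P n).real A =
        ((iidLaw (volume : Measure I) n).prod (iidLaw (P.map Prod.snd) n)).real
          ((fun q i => quantileObs f (q.1 i, q.2 i)) ⁻¹' A) := fun A hA => by
      rw [hlaw, map_measureReal_apply (hΨ n) hA]
    have hdm : Measurable fun w : Fin n → 𝓧 × 𝓨 × 𝓩 => |φ n w -
        {w : Fin n → 𝓧 × 𝓨 × 𝓩 | x < (∑ i, residual P ψ (w i)) / √n}.indicator 1 w| :=
      ((hφ n).measurable_test.sub (measurable_one.indicator hset)).abs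
    rw [e₁ _ hset₁, e₁ _ hset₂, hlaw, integral_map (hΨ n).aemeasurable hdm.aestronglyMeasurable]
    refine hmain.trans (le_of_eq ?_)
    congr 3
    congr 1
    ext q
    have hsum : T n (fun i => quantileObs f (q.1 i, q.2 i)) - (∑ i, e (q.2 i)) / √n -
        (∑ i, r (q.1 i, q.2 i)) / √n = T n (fun i => quantileObs f (q.1 i, q.2 i)) -
          (∑ i, ψ (quantileObs f (q.1 i, q.2 i))) / √n := by
      simp only [hr, residual, he, Finset.sum_sub_distrib, quantileObs]
      ring
    simp only [Set.mem_ofPred_eq, Set.mem_preimage, hsum]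
  rw [tendsto_order]
  refine ⟨fun b hb => Eventually.of_forall fun n =>
    hb.trans_le (integral_nonneg fun w => abs_nonneg _), fun b hb => ?_⟩
  obtain ⟨ε, hε0, hε⟩ : ∃ ε : ℝ, 0 < ε ∧
      (gaussianReal 0 v).real (Set.Icc (x - ε) (x + ε)) < b / 8 := by
    have h1 := (ENNReal.tendsto_toReal ENNReal.zero_ne_top).comp
      (tendsto_measure_Icc (gaussianReal 0 v) x)
    have h2 := h1.mono_left (nhdsWithin_le_nhds (s := Set.Ioi 0))
    rw [ENNReal.toReal_zero] at h2
    obtain ⟨ε, h3, h4⟩ := ((h2.eventually_lt_const (show 0 < b / 8 by positivity)).and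
      self_mem_nhdsWithin).exists
    exact ⟨ε, h4, h3⟩
  have hband := tendsto_real_sum_div_sqrt_null P hrm hψ_sq hr0 hv
    (A := Set.Icc (x - ε) (x + ε)) measurableSet_Icc (by
      rw [frontier_Icc (by linarith)]
      exact (Set.toFinite _).measure_zero _)
  have hlin := (ENNReal.tendsto_toReal ENNReal.zero_ne_top).comp (hT_lin ε hε0)
  rw [ENNReal.toReal_zero] at hlin
  filter_upwards [htail.eventually_lt_const (show 0 < b / 4 by positivity),
    hband.eventually_lt_const hε,
    hlin.eventually_lt_const (show 0 < b / 8 by positivity)] with n h1 h2 h3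
  refine (hcomp ε n).trans_lt ?_
  have h3' : (iidLaw P n).real {w | ε ≤ |T n w - (∑ i, ψ (w i)) / √n|} < b / 8 := h3
  linarith

end Resampling

/-! ### Gaussian tails and the limiting power -/

lemma stdNormalCDF_eq (x : ℝ) : stdNormalCDF x = (gaussianReal 0 1).real (Set.Iic x) :=
  cdf_eq_real _ x

lemma gaussianReal_real_Ioi {v : NNReal} (hv : v ≠ 0) (m x : ℝ) :
    (gaussianReal m v).real (Set.Ioi x) = 1 - stdNormalCDF ((x - m) / √v) := by
  have hσ : 0 < √(v : ℝ) := Real.sqrt_pos.2 (by positivity)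
  have hmap : gaussianReal m v = (gaussianReal 0 1).map fun y => √v * y + m := by
    have h1 : (gaussianReal 0 1).map (fun y => √(v : ℝ) * y) = gaussianReal 0 v := by
      rw [gaussianReal_map_const_mul]
      congr 1
      · simp
      · ext
        simp
    have h2 : (gaussianReal 0 v).map (fun y => y + m) = gaussianReal m v := by
      rw [gaussianReal_map_add_const, zero_add]
    rw [← h2, ← h1, Measure.map_map (by fun_prop) (by fun_prop)]
    rfl
  have hpre : (fun y => √(v : ℝ) * y + m) ⁻¹' Set.Ioi x = (Set.Iic ((x - m) / √v))ᶜ := by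
    ext y
    simp only [Set.mem_preimage, Set.mem_Ioi, Set.mem_compl_iff, Set.mem_Iic, not_le]
    rw [div_lt_iff₀ hσ, sub_lt_iff_lt_add, mul_comm]
  rw [hmap, map_measureReal_apply (by fun_prop) measurableSet_Ioi, hpre,
    probReal_compl_eq_one_sub measurableSet_Iic, stdNormalCDF_eq]

lemma continuous_stdNormalCDF : Continuous stdNormalCDF := by
  have hna : NullSingletonClass (gaussianReal 0 1) := nullSingletonClass_gaussianReal one_ne_zero
  have hm : Monotone stdNormalCDF := monotone_cdf _
  rw [continuous_iff_continuousAt]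
  intro x
  have h0 : (cdf (gaussianReal 0 1)).measure {x} = 0 := by
    rw [measure_cdf]
    exact measure_singleton x
  rw [StieltjesFunction.measure_singleton, ENNReal.ofReal_eq_zero] at h0
  have hl : Function.leftLim stdNormalCDF x = stdNormalCDF x :=
    le_antisymm (hm.leftLim_le le_rfl) (by
      have : stdNormalCDF x - Function.leftLim stdNormalCDF x ≤ 0 := h0
      linarith)
  rw [hm.continuousAt_iff_leftLim_eq_rightLim, hl]
  exact ((cdf (gaussianReal 0 1)).rightLim_eq x).symm

lemma stdNormalCDF_stdNormalQuantile {β : ℝ} (hβ : β ∈ Set.Ioo (0 : ℝ) 1) :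
    stdNormalCDF (stdNormalQuantile β) = β := by
  have hbot : Tendsto stdNormalCDF atBot (𝓝 0) := tendsto_cdf_atBot _
  have htop : Tendsto stdNormalCDF atTop (𝓝 1) := tendsto_cdf_atTop _
  have hm : Monotone stdNormalCDF := monotone_cdf _
  have hcont := continuous_stdNormalCDF
  set s : Set ℝ := {x : ℝ | β ≤ stdNormalCDF x} with hs
  obtain ⟨a, ha⟩ := (hbot.eventually_lt_const hβ.1).exists
  obtain ⟨b, hb⟩ := (htop.eventually_const_lt hβ.2).exists
  have hne : s.Nonempty := ⟨b, hb.le⟩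
  have hbdd : BddBelow s := ⟨a, fun y hy => by
    by_contra hlt
    exact absurd (hm (not_le.1 hlt).le) (not_le.2 (ha.trans_le hy))⟩
  have hclosed : IsClosed s := isClosed_le continuous_const hcont
  refine le_antisymm ?_ (hclosed.csInf_mem hne hbdd)
  refine le_of_tendsto ((hcont.tendsto (sInf s)).mono_left nhdsWithin_le_nhds :
    Tendsto stdNormalCDF (𝓝[<] (sInf s)) _) ?_
  filter_upwards [self_mem_nhdsWithin] with y hy
  exact (not_le.1 fun h => notMem_of_lt_csInf hy hbdd h).le

/-- The covariance is recovered from the correlation, also when a variance vanishes. -/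
lemma sqrt_variance_mul_corr {S : Type*} [MeasurableSpace S] {P : Measure S}
    [IsProbabilityMeasure P] {f g : S → ℝ} (hf : MemLp f 2 P) (hg : MemLp g 2 P) :
    √(Var[g; P]) * corr f g P = cov[f, g; P] / √(Var[f; P]) := by
  by_cases h0 : √(Var[g; P]) = 0
  · have h1 := integral_abs_mul_abs_le_sqrt_mul_sqrt
      (hf.sub (memLp_const (∫ w, f w ∂P))) (hg.sub (memLp_const (∫ w, g w ∂P)))
    have h2 : |cov[f, g; P]| ≤ 0 := by
      rw [variance_eq_integral hg.aestronglyMeasurable.aemeasurable] at h0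
      simp only [Pi.sub_apply, h0, mul_zero, ← abs_mul] at h1
      exact abs_integral_le_integral_abs.trans h1
    have h3 : cov[f, g; P] = 0 := abs_nonpos_iff.1 h2
    simp [h3, h0]
  · rw [corr, mul_div_assoc', mul_comm (√(Var[f; P])), mul_div_mul_left _ _ h0]

end LocalCRT

theorem mainTheorem11
    {𝓧 𝓨 𝓩 : Type*} [MeasurableSpace 𝓧] [MeasurableSpace 𝓨] [MeasurableSpace 𝓩]
    [StandardBorelSpace 𝓧] [StandardBorelSpace 𝓨] [StandardBorelSpace 𝓩] [Nonempty 𝓧]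
    -- the model `{P θ : θ ∈ Θ}`; the values of `P` and `p` outside `Θ` play no role
    (Θ : Set ℝ) (hΘ : IsOpen Θ) (θ₀ : ℝ) (hθ₀ : θ₀ ∈ Θ)
    (P : ℝ → Measure (𝓧 × 𝓨 × 𝓩)) [∀ θ, IsProbabilityMeasure (P θ)]
    (μ : Measure (𝓧 × 𝓨 × 𝓩)) [SigmaFinite μ]
    (p : ℝ → 𝓧 × 𝓨 × 𝓩 → ℝ) (hp : LocalCRT.IsDensityOn P μ p Θ)
    (η : 𝓧 × 𝓨 × 𝓩 → ℝ) (hη : LocalCRT.IsQMDAt μ p θ₀ η)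
    -- under the null distribution, `X` and `Y` are independent given `Z`
    (hnull : CondIndepFun
      (MeasurableSpace.comap (fun w : 𝓧 × 𝓨 × 𝓩 => w.2.2) inferInstance)
      (measurable_snd.comp measurable_snd).comap_le
      (fun w : 𝓧 × 𝓨 × 𝓩 => w.1) (fun w : 𝓧 × 𝓨 × 𝓩 => w.2.1) (P θ₀))
    -- the asymptotically linear statistic
    (ψ : 𝓧 × 𝓨 × 𝓩 → ℝ) (hψ : Measurable ψ) (hψ_int : Integrable ψ (P θ₀))
    (hψ_sq : MemLp (LocalCRT.residual (P θ₀) ψ) 2 (P θ₀))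
    (hψ_var : 0 < Var[LocalCRT.residual (P θ₀) ψ; P θ₀])
    (T : ∀ n : ℕ, (Fin n → 𝓧 × 𝓨 × 𝓩) → ℝ) (hT : ∀ n, Measurable (T n))
    (hT_lin : LocalCRT.IsAsympLinear (P θ₀) T ψ)
    -- the level-`α` CRT based on `T`
    (α : ℝ) (hα : α ∈ Set.Ioo (0 : ℝ) 1)
    (c : ∀ n : ℕ, (Fin n → 𝓨 × 𝓩) → ℝ) (φ : ∀ n : ℕ, (Fin n → 𝓧 × 𝓨 × 𝓩) → ℝ)
    (hφ : ∀ n, LocalCRT.IsCRT (P θ₀) α (T n) (c n) (φ n)) (h : ℝ) :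
    Tendsto
        (fun n : ℕ => ∫ w, φ n w ∂(LocalCRT.iidLaw (P (θ₀ + h / √(n : ℝ))) n))
        atTop
        (𝓝 (1 - LocalCRT.stdNormalCDF (LocalCRT.stdNormalQuantile (1 - α) -
          h * √(Var[LocalCRT.score p θ₀ η; P θ₀]) *
            LocalCRT.corr (LocalCRT.residual (P θ₀) ψ) (LocalCRT.score p θ₀ η) (P θ₀)))) ∧
      ((∀ᵐ w ∂(P θ₀), DifferentiableAt ℝ (fun θ => p θ w) θ₀) →
        LocalCRT.score p θ₀ η =ᵐ[P θ₀] fun w => deriv (fun θ => p θ w) θ₀ / p θ₀ w) := by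
  refine ⟨?_, hη.score_ae_eq hp hΘ hθ₀⟩
  have hηm := hη.1
  have hm₀ := (hp θ₀ hθ₀).1
  have hP₀ := hp.eq_sqMeasure hθ₀
  have hq := hη.isQMDSeq hp hΘ hθ₀ h
  have hηL := hη.memLp hp hΘ hθ₀
  have hle : MeasurableSpace.comap (Prod.snd : 𝓧 × 𝓨 × 𝓩 → 𝓨 × 𝓩) inferInstance ≤
      (inferInstance : MeasurableSpace (𝓧 × 𝓨 × 𝓩)) := measurable_snd.comap_le
  have hrm : Measurable (LocalCRT.residual (P θ₀) ψ) :=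
    hψ.sub (stronglyMeasurable_condExp.mono hle).measurable
  have hr0 : ∫ w, LocalCRT.residual (P θ₀) ψ w ∂(P θ₀) = 0 := by
    unfold LocalCRT.residual LocalCRT.condMeanYZ
    rw [integral_sub hψ_int integrable_condExp, integral_condExp hle, sub_self]
  set r := LocalCRT.residual (P θ₀) ψ with hr
  set s := LocalCRT.score p θ₀ η with hs
  obtain ⟨v, hvdef⟩ : ∃ v : NNReal, (v : ℝ) = Var[r; P θ₀] :=
    ⟨Var[r; P θ₀].toNNReal, Real.coe_toNNReal _ hψ_var.le⟩
  have hv0 : v ≠ 0 := fun h0 => by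
    rw [← hvdef, h0] at hψ_var
    exact lt_irrefl _ hψ_var
  have hv : ∫ w, r w ^ 2 ∂(P θ₀) = v := by
    rw [hvdef, variance_eq_integral hrm.aemeasurable, hr0]
    simp
  have hsm : Measurable s := (hηm.const_mul 2).div hm₀.sqrt
  -- the score is square integrable, and pairs with `r` through `η`
  have hs_mul : ∀ᵐ w ∂μ, √(p θ₀ w) * s w = 2 * η w := by
    filter_upwards [hη.ae_eq_zero hm₀] with w hw
    by_cases h0 : √(p θ₀ w) = 0
    · rw [h0, hw h0]
      simp
    · simp only [hs, LocalCRT.score]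
      field_simp
  have hsL : MemLp s 2 (P θ₀) := by
    rw [memLp_two_iff_integrable_sq hsm.aestronglyMeasurable, hP₀,
      LocalCRT.integrable_sqMeasure_iff hm₀.sqrt]
    refine (hηL.const_mul 2).integrable_sq.congr ?_
    filter_upwards [hs_mul] with w hw
    rw [← hw, smul_eq_mul]
    ring
  have hcov : cov[r, s; P θ₀] = ∫ w, r w * √(p θ₀ w) * (2 * η w) ∂μ := by
    rw [covariance_eq_sub hψ_sq hsL, hr0, zero_mul, sub_zero]
    have : ∫ w, (r * s) w ∂(P θ₀) = ∫ w, √(p θ₀ w) ^ 2 • (r * s) w ∂μ := by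
      conv_lhs => rw [hP₀]
      exact LocalCRT.integral_sqMeasure hm₀.sqrt _
    rw [this]
    refine integral_congr_ae ?_
    filter_upwards [hs_mul] with w hw
    rw [← hw, smul_eq_mul, Pi.mul_apply]
    ring
  have hm : ∫ w, r w * √(p θ₀ w) * (2 * (h * η w)) ∂μ = h * cov[r, s; P θ₀] := by
    rw [hcov, ← integral_const_mul]
    refine integral_congr_ae (ae_of_all _ fun w => ?_)
    simp only
    ring
  set z := LocalCRT.stdNormalQuantile (1 - α) with hz
  have hz1 : LocalCRT.stdNormalCDF z = 1 - α :=
    LocalCRT.stdNormalCDF_stdNormalQuantile ⟨by linarith [hα.2], by linarith [hα.1]⟩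
  have hσ : 0 < √(v : ℝ) := Real.sqrt_pos.2 (hvdef ▸ hψ_var)
  -- the cutoff of the comparison test is the `1 - α` quantile of `N(0, v)`
  set x := √(v : ℝ) * z with hx
  have hxα : (gaussianReal 0 v).real (Set.Ioi x) = α := by
    rw [LocalCRT.gaussianReal_real_Ioi hv0, sub_zero, hx, mul_div_cancel_left₀ _ hσ.ne', hz1]
    ring
  have hset : ∀ n : ℕ, MeasurableSet {w : Fin n → 𝓧 × 𝓨 × 𝓩 | x < (∑ i, r (w i)) / √n} :=
    fun n => measurableSet_lt measurable_const (LocalCRT.measurable_sum_div_sqrt hrm n)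
  set G : ∀ n : ℕ, (Fin n → 𝓧 × 𝓨 × 𝓩) → ℝ := fun n =>
    {w : Fin n → 𝓧 × 𝓨 × 𝓩 | x < (∑ i, r (w i)) / √n}.indicator 1 with hG
  have hGm : ∀ n, Measurable (G n) := fun n => measurable_one.indicator (hset n)
  have hG01 : ∀ n w, G n w ∈ Set.Icc (0 : ℝ) 1 := fun n w => by
    simp only [hG, Set.indicator_apply, Pi.one_apply]
    split_ifs <;> simp
  have hdiff01 : ∀ n w, |φ n w - G n w| ∈ Set.Icc (0 : ℝ) 1 := fun n w => by
    refine ⟨abs_nonneg _, ?_⟩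
    have h1 := (hφ n).mem_unit w
    have h2 := hG01 n w
    rw [abs_le]
    constructor <;> linarith [h1.1, h1.2, h2.1, h2.2]
  have hnull_lim := LocalCRT.tendsto_integral_abs_crt_sub_indicator (P θ₀) hnull hψ hψ_int hψ_sq hT
    hT_lin hφ hv0 hv hxα
  rw [← hr] at hnull_lim
  have halt := hq.tendsto_integral_zero (f := fun n w => |φ n w - G n w|)
    (fun n => ((hφ n).measurable_test.sub (hGm n)).abs) hdiff01 (by rw [← hP₀]; exact hnull_lim)
  have hna : NullSingletonClass (gaussianReal (h * cov[r, s; P θ₀]) v) :=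
    nullSingletonClass_gaussianReal hv0
  have hpow := hq.tendsto_real_sum_div_sqrt hrm (by rw [← hP₀]; exact hψ_sq)
    (by rw [← hP₀]; exact hr0) (v := v) (by rw [← hP₀]; exact hv) hm (A := Set.Ioi x)
    measurableSet_Ioi (by rw [frontier_Ioi]; exact measure_singleton x)
  have hlimit : (gaussianReal (h * cov[r, s; P θ₀]) v).real (Set.Ioi x) =
      1 - LocalCRT.stdNormalCDF (z - h * √(Var[s; P θ₀]) * LocalCRT.corr r s (P θ₀)) := by
    rw [LocalCRT.gaussianReal_real_Ioi hv0, mul_assoc, LocalCRT.sqrt_variance_mul_corr hψ_sq hsL,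
      ← hvdef, sub_div, hx, mul_div_cancel_left₀ _ hσ.ne', mul_div_assoc]
  rw [hlimit] at hpow
  have hsum : Tendsto (fun n : ℕ => ∫ w, φ n w
      ∂(LocalCRT.iidLaw (LocalCRT.sqMeasure μ (LocalCRT.localHalfDensity p Θ θ₀ h n)) n)) atTop
      (𝓝 (1 - LocalCRT.stdNormalCDF (z - h * √(Var[s; P θ₀]) * LocalCRT.corr r s (P θ₀)))) := by
    refine (tendsto_iff_of_dist (squeeze_zero (fun _ => dist_nonneg) (fun n => ?_) halt)).2 hpow
    have hQ := LocalCRT.isProbabilityMeasure_sqMeasure (hq.memLp_seq n) (hq.integral_seq n)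
    have hQn := LocalCRT.isProbabilityMeasure_iidLaw
      (LocalCRT.sqMeasure μ (LocalCRT.localHalfDensity p Θ θ₀ h n)) n
    have hint : ∀ {g : (Fin n → 𝓧 × 𝓨 × 𝓩) → ℝ}, Measurable g →
        (∀ w, g w ∈ Set.Icc (0 : ℝ) 1) → Integrable g (LocalCRT.iidLaw
          (LocalCRT.sqMeasure μ (LocalCRT.localHalfDensity p Θ θ₀ h n)) n) := fun hg h01 =>
      Integrable.of_bound hg.aestronglyMeasurable 1 (ae_of_all _ fun w => by
        rw [Real.norm_of_nonneg (h01 w).1]; exact (h01 w).2)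
    have hGint : ∫ w, G n w ∂(LocalCRT.iidLaw
        (LocalCRT.sqMeasure μ (LocalCRT.localHalfDensity p Θ θ₀ h n)) n) = (LocalCRT.iidLaw
        (LocalCRT.sqMeasure μ (LocalCRT.localHalfDensity p Θ θ₀ h n)) n).real
          {w | (∑ i, r (w i)) / √n ∈ Set.Ioi x} := integral_indicator_one (hset n)
    rw [← hGint, Real.dist_eq, ← integral_sub (hint (hφ n).measurable_test (hφ n).mem_unit)
      (hint (hGm n) (hG01 n))]
    exact abs_integral_le_integral_abs
  refine hsum.congr' ?_
  -- for large `n` the parameter lies in `Θ`, and the half-density is `√p`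
  filter_upwards [LocalCRT.eventually_localParam_mem hΘ hθ₀ h] with n hn
  have : LocalCRT.localHalfDensity p Θ θ₀ h n = fun w => √(p (θ₀ + h / √n) w) := by
    ext w
    simp [LocalCRT.localHalfDensity, hn]
  rw [hp.eq_sqMeasure hn, this]
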